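/- Let $\Gamma$ be a finitely generated amenable group (that is, there is a finitely additive left-invariant probability measure defined on all subsets of $\Gamma$), let $\Sigma$ be a finite symmetric generating set of $\Gamma$, and let $H\le\Gamma$ be a subgroup. The Schreier graph $\mathrm{Sch}(\Gamma/H,\Sigma)$ is the simple graph whose vertices are the right cosets $Ha$ $(a\in\Gamma)$, where $Ha$ is adjacent to $Hb\neq Ha$ if $Hb=Ha\sigma$ for some $\sigma\in\Sigma$. For a countable graph $G$ of bounded vertex degree and a finite set $F$ of vertices, let $\partial(F)$ be the set of vertices in $F$ that are adjacent to a vertex not in $F$; a nonempty finite set $F$ is $\varepsilon$-Følner if $|\partial(F)|/|F|<\varepsilon$. An $(\varepsilon,r)$-Følner packing of $G$ is a family of pairwise disjoint $\varepsilon$-Følner sets, each of diameter at most $r$ in the graph metric of $G$; it is a tiling if its members cover $V(G)$. The space of packings carries the topology of pointwise convergence of the relation "$x$ and $y$ lie in a common member of the packing" on $V(G)\times V(G)$. The graph $G$ is strongly almost finite if for every $\varepsilon>0$ there exist an integer $r\ge 1$ and a Borel probability measure $\nu$ on the space of $(\varepsilon,r)$-Følner packings of $G$ that is concentrated on tilings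 and such that, for each $x\in V(G)$, the $\nu$-measure of the set of tilings for which $x$ is on the boundary $\partial(T)$ of the tile $T$ containing $x$ is less than $\varepsilon$. Then the graph $\mathrm{Sch}(\Gamma/H,\Sigma)$ is strongly almost finite. (In particular, taking $H=\{e\}$, the Cayley graph of $\Gamma$ with respect to $\Sigma$ is strongly almost finite.) -/

import Mathlib

open scoped Pointwise

/-- Amenability of a (discrete) group in the sense of von Neumann: there is a finitely additive
left-invariant probability measure defined on all subsets of the group. -/
def IsAmenableGroup (Γ : Type*) [Group Γ] : Prop :=
  ∃ m : Set Γ → ℝ,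
    (∀ A, 0 ≤ m A) ∧ m Set.univ = 1 ∧
    (∀ A B, Disjoint A B → m (A ∪ B) = m A + m B) ∧
    ∀ (g : Γ) (A : Set Γ), m (g • A) = m A

/-- The vertex set of the Schreier graph: the right cosets `H a` of `H`. -/
abbrev RightCoset {Γ : Type*} [Group Γ] (H : Subgroup Γ) : Type _ :=
  Quotient (QuotientGroup.rightRel H)

/-- The right coset `H a`. -/
def rightCoset {Γ : Type*} [Group Γ] (H : Subgroup Γ) (a : Γ) : RightCoset H :=
  Quotient.mk (QuotientGroup.rightRel H) a

/-- The Schreier graph `Sch(Γ/H, S)` of a symmetric set `S`: its vertices are the right cosets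
of `H`, and `H a` is adjacent to `H b ≠ H a` if `H b = H a σ` for some `σ ∈ S`. -/
def schreierGraph {Γ : Type*} [Group Γ] (H : Subgroup Γ) (S : Finset Γ)
    (hS : ∀ σ ∈ S, σ⁻¹ ∈ S) : SimpleGraph (RightCoset H) where
  Adj p q := p ≠ q ∧ ∃ a : Γ, ∃ σ ∈ S, p = rightCoset H a ∧ q = rightCoset H (a * σ)
  symm := ⟨by
    rintro p q ⟨hpq, a, σ, hσ, rfl, rfl⟩
    exact ⟨hpq.symm, a * σ, σ⁻¹, hS σ hσ, rfl, by simp⟩⟩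
  loopless := ⟨fun _ h => h.1 rfl⟩

section Graph

variable {V : Type*}

/-- `G` is a countable graph all of whose vertex degrees are at most `d`. -/
def IsCountableOfDegreeLE (G : SimpleGraph V) (d : ℕ) : Prop :=
  Countable V ∧ ∀ x : V, (G.neighborSet x).encard ≤ d

open Classical in
/-- `∂F`: the vertices of `F` that are adjacent to a vertex that is not in `F`. -/
noncomputable def innerBoundary (G : SimpleGraph V) (F : Finset V) : Finset V :=
  F.filter fun x => ∃ y, G.Adj x y ∧ y ∉ F

/-- A nonempty finite set `F` of vertices is `ε`-Følner if `|∂F| / |F| < ε`. -/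
def IsFolnerSet (G : SimpleGraph V) (ε : ℝ) (F : Finset V) : Prop :=
  F.Nonempty ∧ ((innerBoundary G F).card : ℝ) / (F.card : ℝ) < ε

/-- An `(ε, r)`-Følner packing of `G`: a family of pairwise disjoint `ε`-Følner sets, each of
diameter at most `r` in the graph metric of `G`. -/
structure FolnerPacking (G : SimpleGraph V) (ε : ℝ) (r : ℕ) where
  /-- The members of the packing. -/
  tiles : Set (Finset V)
  pairwiseDisjoint : ∀ T ∈ tiles, ∀ T' ∈ tiles, T ≠ T' → Disjoint T T'
  isFolnerSet : ∀ T ∈ tiles, IsFolnerSet G ε T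
  diam_le : ∀ T ∈ tiles, ∀ x ∈ T, ∀ y ∈ T, G.edist x y ≤ r

namespace FolnerPacking

variable {G : SimpleGraph V} {ε : ℝ} {r : ℕ}

/-- `x` and `y` lie in a common member of the packing; for `x = y` this says that `x` is
covered by the packing. -/
def SameTile (P : FolnerPacking G ε r) (x y : V) : Prop :=
  ∃ T ∈ P.tiles, x ∈ T ∧ y ∈ T

/-- A packing is a tiling if it covers all vertices. -/
def IsTiling (P : FolnerPacking G ε r) : Prop :=
  ∀ x : V, ∃ T ∈ P.tiles, x ∈ T

open Classical in
/-- The topology on packings: two packings are close if their relations `SameTile` agree on a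
large finite set of pairs of vertices (the topology of pointwise convergence of `SameTile`). -/
noncomputable instance : TopologicalSpace (FolnerPacking G ε r) :=
  TopologicalSpace.induced
    (fun (P : FolnerPacking G ε r) (p : V × V) => (decide (P.SameTile p.1 p.2) : Bool))
    inferInstance

/-- Packings carry the Borel `σ`-algebra of this topology. -/
noncomputable instance : MeasurableSpace (FolnerPacking G ε r) := borel _

instance : BorelSpace (FolnerPacking G ε r) := ⟨rfl⟩

end FolnerPacking

/-- `G` is strongly almost finite: `G` is a countable graph of bounded degree, and for any
`ε > 0` there are `r ≥ 1` and a Borel probability measure `ν` on the space of `(ε, r)`-Følner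
packings, concentrated on tilings, such that every vertex `x` is on the boundary of the tile
containing it with `ν`-probability less than `ε`. -/
def IsStronglyAlmostFinite (G : SimpleGraph V) : Prop :=
  (∃ d : ℕ, IsCountableOfDegreeLE G d) ∧
  ∀ ε : ℝ, 0 < ε → ∃ r : ℕ, 1 ≤ r ∧
    ∃ ν : MeasureTheory.Measure (FolnerPacking G ε r),
      MeasureTheory.IsProbabilityMeasure ν ∧
      (∀ᵐ P ∂ν, P.IsTiling) ∧
      ∀ x : V, ν {P | ∃ T ∈ P.tiles, x ∈ innerBoundary G T} < ENNReal.ofReal ε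

end Graph

/-! The action of `Γ` on the cosets need not be free, so Følner sets of `Γ` cannot simply be copied
into the graph. Two weaker objects are built and then merged.

The first (`exists_partition_family`) is a random partition `q` with bounded classes for which every
point is rarely on the boundary. For a Følner set `F`, each point `x` picks the first element, in a
random order, of the multiset `F • x`. Neighbouring points have almost the same multiset, hence
usually make the same choice. The classes of `q` need not be Følner.

The second (`exists_sparse_excSet`) is a single partition `p` with bounded classes whose exceptional
set `X`, consisting of boundary points and points of non-Følner classes, is sparse as seen from
every point. It is an ultralimit of partitions minimising the boundary in finite sets: pasting in a
good partition from the random family cannot improve it, so its boundary has small density in every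
finite set with small edge boundary.

To merge them, all `q`-classes meeting `X` are handed over, each as a whole, to nearby Følner
classes of `p`; all other points stay in their `p`-class. Sparsity of `X` gives Hall's condition
(`exists_assignment`), so no class absorbs much, and a Følner class of `p` also loses little. The
resulting classes are Følner, and they are cut only where `q` is cut (`exists_folner_partition`).
With `p` fixed and `q` running through the random family, the uniform measure on the resulting
tilings is as required. -/

/-! ### Følner sets from an invariant mean -/

section Amenable

theorem mean_empty {α : Type*} {m : Set α → ℝ}
    (hadd : ∀ A B, Disjoint A B → m (A ∪ B) = m A + m B) : m ∅ = 0 := by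
  have h := hadd ∅ ∅ disjoint_bot_left
  rw [Set.union_self] at h
  linarith

theorem mean_biUnion {α ι : Type*} {m : Set α → ℝ}
    (hadd : ∀ A B, Disjoint A B → m (A ∪ B) = m A + m B) (s : Finset ι) (A : ι → Set α)
    (hA : ∀ i ∈ s, ∀ j ∈ s, i ≠ j → Disjoint (A i) (A j)) :
    m (⋃ i ∈ s, A i) = ∑ i ∈ s, m (A i) := by
  classical
  induction s using Finset.induction_on with
  | empty => simpa using mean_empty hadd
  | insert a s ha ih =>
    rw [Finset.set_biUnion_insert, Finset.sum_insert ha, hadd, ih]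
    · exact fun i hi j hj => hA i (Finset.mem_insert_of_mem hi) j (Finset.mem_insert_of_mem hj)
    · simp only [Set.disjoint_iUnion_right]
      exact fun i hi => hA a (Finset.mem_insert_self _ _) i (Finset.mem_insert_of_mem hi)
        (fun h => ha (h ▸ hi))

variable {Γ : Type*} [Group Γ]

open Classical in
/-- In an amenable group no finite set doubles the size of all finite sets: otherwise Hall's
theorem would give a paradoxical decomposition. -/
theorem IsAmenableGroup.exists_card_mul_lt (h : IsAmenableGroup Γ) (K : Finset Γ) :
    ∃ F : Finset Γ, (K * F).card < 2 * F.card := by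
  obtain ⟨m, hnn, huniv, hadd, hinv⟩ := h
  by_contra! hK
  -- Hall's theorem embeds two copies of `Γ` into `Γ`, moving each point by left multiplication with
  -- an element of `K`.
  obtain ⟨f, hf, hfK⟩ := (Finset.all_card_le_biUnion_card_iff_exists_injective
    (fun p : Γ × Bool => K.image (· * p.1))).1 (by
      intro s
      have h1 : s.card ≤ ((s.image Prod.fst) ×ˢ (Finset.univ : Finset Bool)).card := by
        apply Finset.card_le_card
        intro p hp
        simp only [Finset.mem_product, Finset.mem_image, Finset.mem_univ, and_true]
        exact ⟨p, hp, rfl⟩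
      rw [Finset.card_product, Finset.card_univ, Fintype.card_bool] at h1
      have h2 := hK (s.image Prod.fst)
      refine h1.trans ((by omega : _ ≤ _).trans (h2.trans (Finset.card_le_card ?_)))
      intro x hx
      obtain ⟨k, hk, g, hg, rfl⟩ := Finset.mem_mul.1 hx
      obtain ⟨p, hp, rfl⟩ := Finset.mem_image.1 hg
      exact Finset.mem_biUnion.2 ⟨p, hp, Finset.mem_image.2 ⟨k, hk, rfl⟩⟩)
  let A : Γ → Bool → Set Γ := fun k b => {g | f (g, b) = k * g}
  have hsum (b : Bool) : ∑ k ∈ K, m (A k b) = 1 := by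
    rw [← mean_biUnion hadd K (fun k => A k b), ← huniv]
    · congr 1
      refine Set.eq_univ_of_forall fun g => ?_
      obtain ⟨k, hk, hkg⟩ := Finset.mem_image.1 (hfK (g, b))
      exact Set.mem_biUnion hk hkg.symm
    · intro i _ j _ hij
      refine Set.disjoint_left.2 fun g hi hj => hij ?_
      exact mul_right_cancel ((show f (g, b) = i * g from hi).symm.trans hj)
  have hmono (B : Set Γ) : m B ≤ 1 := by
    have h1 := hadd B Bᶜ disjoint_compl_right
    rw [Set.union_compl_self, huniv] at h1
    linarith [hnn Bᶜ]
  -- By injectivity of `f` the translated pieces are disjoint. For each `b` the pieces have total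
  -- mass 1, so the union of the translates would have mass 2.
  have htot := mean_biUnion hadd (K ×ˢ (Finset.univ : Finset Bool)) (fun p => p.1 • A p.1 p.2) (by
    rintro ⟨k, b⟩ _ ⟨k', b'⟩ _ hne
    refine Set.disjoint_left.2 ?_
    rintro _ ⟨g, hg, rfl⟩ ⟨g', hg', he⟩
    have h1 : f (g, b) = k * g := hg
    have h2 : f (g', b') = k' * g' := hg'
    have h3 : k' * g' = k * g := he
    have h4 := hf (h1.trans (h3.symm.trans h2.symm))
    simp only [Prod.mk.injEq] at h4
    obtain ⟨rfl, rfl⟩ := h4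
    exact hne (by rw [mul_right_cancel h3]))
  rw [Finset.sum_product_right] at htot
  simp only [hinv, hsum] at htot
  have := hmono (⋃ p ∈ K ×ˢ (Finset.univ : Finset Bool), p.1 • A p.1 p.2)
  rw [htot] at this
  norm_num at this

open Classical in
/-- An amenable group has finite sets that are almost invariant under left multiplication. -/
theorem IsAmenableGroup.exists_left_folner (h : IsAmenableGroup Γ) (S : Finset Γ) {δ : ℝ}
    (hδ : 0 < δ) : ∃ F : Finset Γ, F.Nonempty ∧
      ∀ σ ∈ S, ((F.image (σ * ·) \ F).card : ℝ) ≤ δ * F.card := by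
  by_contra! hF
  set K : Finset Γ := insert 1 S with hKdef
  have hstep (F : Finset Γ) : (1 + δ) * F.card ≤ (K * F).card := by
    rcases F.eq_empty_or_nonempty with rfl | hne
    · simp
    obtain ⟨σ, hσ, hlt⟩ := hF F hne
    have h1 : F.card + (F.image (σ * ·) \ F).card ≤ (K * F).card := by
      rw [← Finset.card_union_of_disjoint Finset.disjoint_sdiff]
      refine Finset.card_le_card (Finset.union_subset ?_ ?_)
      · exact fun x hx => Finset.mem_mul.2 ⟨1, Finset.mem_insert_self _ _, x, hx, one_mul x⟩
      · intro x hx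
        obtain ⟨y, hy, rfl⟩ := Finset.mem_image.1 (Finset.mem_sdiff.1 hx).1
        exact Finset.mul_mem_mul (Finset.mem_insert_of_mem hσ) hy
    have h2 : (F.card : ℝ) + (F.image (σ * ·) \ F).card ≤ (K * F).card := by exact_mod_cast h1
    linarith
  -- Without an almost invariant set, each multiplication by `K` gains a factor `1 + δ`, so some
  -- power of `K` doubles every finite set.
  have hpow (n : ℕ) (F : Finset Γ) : (1 + δ) ^ n * F.card ≤ (K ^ n * F).card := by
    induction n with
    | zero => simp
    | succ n ih =>
      rw [pow_succ' K, mul_assoc K, pow_succ' (1 + δ), mul_assoc]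
      exact (mul_le_mul_of_nonneg_left ih (by linarith)).trans (hstep _)
  obtain ⟨n, hn⟩ := pow_unbounded_of_one_lt 2 (by linarith : 1 < 1 + δ)
  obtain ⟨F, hlt⟩ := h.exists_card_mul_lt (K ^ n)
  have h1 := hpow n F
  have h2 : ((K ^ n * F).card : ℝ) < 2 * F.card := by exact_mod_cast hlt
  nlinarith [(Nat.cast_nonneg F.card : (0 : ℝ) ≤ F.card)]

open Classical in
/-- An amenable group has finite sets that are almost invariant under right multiplication. -/
theorem IsAmenableGroup.exists_folner (h : IsAmenableGroup Γ) (S : Finset Γ) {δ : ℝ}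
    (hδ : 0 < δ) : ∃ F : Finset Γ, F.Nonempty ∧
      ∀ σ ∈ S, ((F.image (· * σ) \ F).card : ℝ) ≤ δ * F.card ∧
        ((F \ F.image (· * σ)).card : ℝ) ≤ δ * F.card := by
  obtain ⟨F, hne, hF⟩ := h.exists_left_folner S⁻¹ hδ
  refine ⟨F⁻¹, hne.inv, fun σ hσ => ?_⟩
  have h1 : ((F⁻¹.image (· * σ) \ F⁻¹).card : ℝ) ≤ δ * F⁻¹.card := by
    convert hF σ⁻¹ (Finset.inv_mem_inv hσ) using 2
    · rw [← Finset.card_inv (F.image _ \ F)]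
      congr 2
      ext x
      simp only [Finset.mem_sdiff, Finset.mem_image, Finset.mem_inv']
      refine and_congr_left fun _ => ⟨?_, ?_⟩
      · rintro ⟨y, hy, rfl⟩
        exact ⟨y⁻¹, hy, by simp⟩
      · rintro ⟨y, hy, hyx⟩
        exact ⟨y⁻¹, by simpa using hy, by rw [← inv_inv x, ← hyx]; simp⟩
    · rw [Finset.card_inv]
  refine ⟨h1, ?_⟩
  rwa [Finset.card_sdiff_comm]
  rw [Finset.card_image_of_injective _ (mul_left_injective σ)]

end Amenable

/-! ### Multisets of points as sets of layers -/

section Layers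

open Classical in
/-- The subgraph of the counting function of a finite family of points of `V`: it contains the
pairs `(z, j)` such that more than `j` members of the family are equal to `z`. -/
noncomputable def layers {α V : Type*} (I : Finset α) (u : α → V) : Finset (Σ _ : V, ℕ) :=
  (I.image u).sigma fun z => Finset.range (I.filter fun i => u i = z).card

variable {α β V : Type*}

open Classical in
theorem mem_layers {I : Finset α} {u : α → V} {l : Σ _ : V, ℕ} :
    l ∈ layers I u ↔ l.2 < (I.filter fun i => u i = l.1).card := by
  simp only [layers, Finset.mem_sigma, Finset.mem_image, Finset.mem_range, and_iff_right_iff_imp]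
  intro h
  obtain ⟨i, hi⟩ := Finset.card_pos.1 ((Nat.zero_le _).trans_lt h)
  exact ⟨i, (Finset.mem_filter.1 hi).1, (Finset.mem_filter.1 hi).2⟩

theorem exists_of_mem_layers {I : Finset α} {u : α → V} {l : Σ _ : V, ℕ} (h : l ∈ layers I u) :
    ∃ i ∈ I, u i = l.1 := by
  classical
  exact Finset.mem_image.1 (Finset.mem_sigma.1 h).1

theorem snd_lt_of_mem_layers {I : Finset α} {u : α → V} {l : Σ _ : V, ℕ} (h : l ∈ layers I u) :
    l.2 < I.card := by
  classical
  exact (mem_layers.1 h).trans_le (Finset.card_filter_le _ _)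

theorem card_layers (I : Finset α) (u : α → V) : (layers I u).card = I.card := by
  classical
  simp only [layers, Finset.card_sigma, Finset.card_range]
  exact (Finset.card_eq_sum_card_image u I).symm

theorem layers_mono {I J : Finset α} (h : I ⊆ J) (u : α → V) : layers I u ⊆ layers J u := by
  classical
  intro l hl
  rw [mem_layers] at hl ⊢
  exact hl.trans_le (Finset.card_le_card (Finset.filter_subset_filter _ h))

-- Replacing `J` by `I ∩ J` only enlarges the left side, and for nested families the sizes subtract.
-- Thus the Følner estimates for `F` in `Γ` pass to the multiset `F • x` even when the orbit map is
-- not injective.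
open Classical in
theorem card_layers_sdiff_le [DecidableEq α] (I J : Finset α) (u : α → V) :
    (layers I u \ layers J u).card ≤ (I \ J).card := by
  calc (layers I u \ layers J u).card
      ≤ (layers I u \ layers (I ∩ J) u).card := Finset.card_le_card
        (Finset.sdiff_subset_sdiff subset_rfl (layers_mono Finset.inter_subset_right u))
    _ = I.card - (I ∩ J).card := by
        rw [Finset.card_sdiff_of_subset (layers_mono Finset.inter_subset_left u), card_layers,
          card_layers]
    _ = (I \ J).card := by
        rw [← Finset.card_sdiff_of_subset Finset.inter_subset_left, Finset.sdiff_inter_self_left]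

open Classical in
theorem layers_image [DecidableEq α] {φ : β → α} (hφ : Function.Injective φ) (J : Finset β) (u : α → V) :
    layers (J.image φ) u = layers J (u ∘ φ) := by
  ext l
  rw [mem_layers, mem_layers, Finset.filter_image, Finset.card_image_of_injective _ hφ]
  rfl

open Classical in
theorem card_layers_filter (I : Finset α) (u : α → V) (X : Set V) :
    ((layers I u).filter fun l => l.1 ∈ X).card = (I.filter fun i => u i ∈ X).card := by
  rw [← card_layers (I.filter fun i => u i ∈ X) u]
  congr 1
  ext l
  rw [Finset.mem_filter, mem_layers, mem_layers, Finset.filter_filter]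
  constructor
  · rintro ⟨h, hX⟩
    refine h.trans_le (Finset.card_le_card fun i hi => ?_)
    rw [Finset.mem_filter] at hi ⊢
    exact ⟨hi.1, hi.2 ▸ hX, hi.2⟩
  · intro h
    obtain ⟨i, hi⟩ := Finset.card_pos.1 ((Nat.zero_le _).trans_lt h)
    rw [Finset.mem_filter] at hi
    refine ⟨h.trans_le (Finset.card_le_card fun i hi => ?_), hi.2.2 ▸ hi.2.1⟩
    rw [Finset.mem_filter] at hi ⊢
    exact ⟨hi.1, hi.2.2⟩

end Layers

/-! ### Colourings and random orders -/

section Colouring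

/-- Greedy colouring along a well-order. -/
theorem exists_greedy_colouring {V : Type*} (N : V → Finset V) (k : ℕ)
    (hN : ∀ x, (N x).card < k) (hsymm : ∀ x y, y ∈ N x → x ∈ N y) :
    ∃ c : V → Fin k, ∀ x, ∀ y ∈ N x, y ≠ x → c y ≠ c x := by
  classical
  have key (x : V) (f : ∀ y, WellOrderingRel y x → Fin k) :
      ∃ n : Fin k, ∀ y (h : WellOrderingRel y x), y ∈ N x → f y h ≠ n := by
    let A : Finset (Fin k) := (N x).attach.biUnion fun y =>
      if h : WellOrderingRel y.1 x then {f y.1 h} else ∅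
    have hA : A.card < (Finset.univ : Finset (Fin k)).card := by
      rw [Finset.card_univ, Fintype.card_fin]
      refine lt_of_le_of_lt ?_ (hN x)
      refine (Finset.card_biUnion_le_card_mul _ _ 1 fun y _ => ?_).trans (by simp)
      split_ifs <;> simp
    obtain ⟨n, -, hn⟩ := Finset.exists_mem_notMem_of_card_lt_card hA
    refine ⟨n, fun y h hy he => hn ?_⟩
    refine Finset.mem_biUnion.2 ⟨⟨y, hy⟩, Finset.mem_attach _ _, ?_⟩
    simp [h, he]
  have wf : WellFounded (WellOrderingRel : V → V → Prop) := IsWellFounded.wf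
  let c : V → Fin k := wf.fix fun x f => (key x f).choose
  have hc (x y : V) (h : WellOrderingRel y x) (hy : y ∈ N x) : c y ≠ c x := by
    have := (key x fun y _ => c y).choose_spec y h hy
    have he : c x = (key x fun y _ => c y).choose := wf.fix_eq _ x
    rwa [← he] at this
  refine ⟨c, fun x y hy hne => ?_⟩
  rcases trichotomous_of WellOrderingRel y x with h | h | h
  · exact hc x y h hy
  · exact absurd h hne
  · exact (hc y x h (hsymm x y hy)).symm

open Classical in
/-- In a random ordering of a finite set, each member of `T` is equally likely to be the first
member of `T`. -/
theorem card_perm_min_mem_mul_le {C : Type*} [Fintype C] [LinearOrder C] {B T : Finset C}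
    (hBT : B ⊆ T) :
    (Finset.univ.filter fun π : Equiv.Perm C => ∃ b ∈ B, ∀ t ∈ T, π b ≤ π t).card * T.card ≤
      B.card * Fintype.card (Equiv.Perm C) := by
  rcases B.eq_empty_or_nonempty with rfl | ⟨b₀, hb₀⟩
  · simp
  let E : C → Finset (Equiv.Perm C) := fun b => Finset.univ.filter fun π => ∀ t ∈ T, π b ≤ π t
  -- Precomposing with the transposition of `b` and `b'` turns orders in which `b` comes first in
  -- `T` into orders in which `b'` does.
  have hle (b b' : C) (hb : b ∈ T) (hb' : b' ∈ T) : (E b).card ≤ (E b').card := by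
    refine Finset.card_le_card_of_injOn (fun π => π * Equiv.swap b b') ?_ ?_
    · intro π hπ
      simp only [E, Finset.coe_filter, Finset.mem_univ, true_and, Set.mem_ofPred_eq,
        Equiv.Perm.mul_apply, Equiv.swap_apply_right] at hπ ⊢
      intro t ht
      apply hπ
      rw [Equiv.swap_apply_def]
      split_ifs <;> assumption
    · exact fun π _ π' _ h => mul_right_cancel h
  have hsum : ∑ b ∈ T, (E b).card ≤ Fintype.card (Equiv.Perm C) := by
    rw [← Finset.card_biUnion]
    · exact Finset.card_le_univ _
    · intro b hb b' hb' hne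
      refine Finset.disjoint_left.2 fun π h h' => hne ?_
      simp only [E, Finset.mem_filter, Finset.mem_univ, true_and] at h h'
      exact π.injective (le_antisymm (h b' hb') (h' b hb))
  have h1 : T.card * (E b₀).card ≤ Fintype.card (Equiv.Perm C) := by
    refine le_trans ?_ hsum
    rw [← smul_eq_mul]
    exact Finset.card_nsmul_le_sum _ _ _ fun b hb => hle b₀ b (hBT hb₀) hb
  have h2 : (Finset.univ.filter fun π : Equiv.Perm C => ∃ b ∈ B, ∀ t ∈ T, π b ≤ π t).card ≤
      B.card * (E b₀).card := by
    refine (Finset.card_le_card ?_).trans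
      (Finset.card_biUnion_le_card_mul B E _ fun b hb => hle b b₀ (hBT hb) (hBT hb₀))
    intro π hπ
    obtain ⟨b, hb, h⟩ := (Finset.mem_filter.1 hπ).2
    exact Finset.mem_biUnion.2 ⟨b, hb, Finset.mem_filter.2 ⟨Finset.mem_univ _, h⟩⟩
  calc _ ≤ B.card * (E b₀).card * T.card := Nat.mul_le_mul_right _ h2
    _ = B.card * (T.card * (E b₀).card) := by ring
    _ ≤ _ := Nat.mul_le_mul_left _ h1

end Colouring

/-! ### Random partitions with rare boundary -/

section Partitions

variable {Γ V : Type*} [Group Γ] [MulAction Γ V]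

/-- The points that some `σ ∈ S` moves to another class of the partition `s`. -/
def bdry (S : Finset Γ) (s : Setoid V) : Set V := {x | ∃ σ ∈ S, ¬ s x (σ • x)}

/-- Points in the same class of `s` differ by an element of `K`. -/
def BoundedBy (K : Finset Γ) (s : Setoid V) : Prop := ∀ x y, s x y → ∃ k ∈ K, y = k • x

open Classical in
/-- For an action of an amenable group there is a random partition, uniformly distributed on
finitely many partitions into uniformly bounded classes, such that each point is unlikely to be
on the boundary. -/
theorem exists_partition_family (V : Type*) [MulAction Γ V] (h : IsAmenableGroup Γ)
    (S : Finset Γ) {δ : ℝ} (hδ : 0 < δ) :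
    ∃ (ι : Type) (_ : Fintype ι) (_ : Nonempty ι) (q : ι → Setoid V) (K : Finset Γ),
      (∀ i, BoundedBy K (q i)) ∧
      ∀ x, ((Finset.univ.filter fun i => x ∈ bdry S (q i)).card : ℝ) ≤ δ * Fintype.card ι := by
  -- The tolerance is shared among two one-sided differences for each generator.
  obtain ⟨F, hFne, hF⟩ := h.exists_folner S (δ := δ / (2 * (S.card + 1))) (by positivity)
  have hFpos : 0 < F.card := hFne.card_pos
  let I : V → Finset (Σ _ : V, ℕ) := fun p => layers F (· • p)
  have hI (σ : Γ) (p : V) : I (σ • p) = layers (F.image (· * σ)) (· • p) := by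
    rw [layers_image (mul_left_injective σ)]
    simp only [I, Function.comp_def, mul_smul]
  let B : V → Finset (Σ _ : V, ℕ) := fun p =>
    S.biUnion fun σ => (I p \ I (σ • p)) ∪ (I (σ • p) \ I p)
  let T : V → Finset (Σ _ : V, ℕ) := fun p => (insert 1 S).biUnion fun σ => I (σ • p)
  have hTI {p : V} {σ : Γ} (hσ : σ ∈ insert 1 S) : I (σ • p) ⊆ T p :=
    Finset.subset_biUnion_of_mem (fun σ => I (σ • p)) hσ
  have hTI1 (p : V) : I p ⊆ T p := by
    simpa using hTI (p := p) (Finset.mem_insert_self 1 S)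
  have hBT (p : V) : B p ⊆ T p := by
    intro l hl
    obtain ⟨σ, hσ, hl⟩ := Finset.mem_biUnion.1 hl
    rcases Finset.mem_union.1 hl with hl | hl
    · exact hTI1 p (Finset.mem_sdiff.1 hl).1
    · exact hTI (Finset.mem_insert_of_mem hσ) (Finset.mem_sdiff.1 hl).1
  have hBcard (p : V) : ((B p).card : ℝ) ≤ δ * F.card := by
    have h1 (σ : Γ) (hσ : σ ∈ S) : (((I p \ I (σ • p)) ∪ (I (σ • p) \ I p)).card : ℝ) ≤
        2 * (δ / (2 * (S.card + 1)) * F.card) := by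
      have h2 : ((I p \ I (σ • p)).card : ℝ) ≤ (F \ F.image (· * σ)).card := by
        rw [hI]
        exact_mod_cast card_layers_sdiff_le F (F.image (· * σ)) (· • p)
      have h3 : ((I (σ • p) \ I p).card : ℝ) ≤ (F.image (· * σ) \ F).card := by
        rw [hI]
        exact_mod_cast card_layers_sdiff_le (F.image (· * σ)) F (· • p)
      have h4 : (((I p \ I (σ • p)) ∪ (I (σ • p) \ I p)).card : ℝ) ≤
          (I p \ I (σ • p)).card + (I (σ • p) \ I p).card := by
        exact_mod_cast Finset.card_union_le _ _
      linarith [hF σ hσ]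
    calc ((B p).card : ℝ)
        ≤ ∑ σ ∈ S, (((I p \ I (σ • p)) ∪ (I (σ • p) \ I p)).card : ℝ) := by
          exact_mod_cast Finset.card_biUnion_le
      _ ≤ ∑ _σ ∈ S, 2 * (δ / (2 * (S.card + 1)) * F.card) := Finset.sum_le_sum h1
      _ = S.card / (S.card + 1) * (δ * F.card) := by
          rw [Finset.sum_const, nsmul_eq_mul]
          field_simp
      _ ≤ 1 * (δ * F.card) := by
          refine mul_le_mul_of_nonneg_right ?_ (by positivity)
          rw [div_le_one (by positivity)]
          linarith
      _ = δ * F.card := one_mul _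
  -- Any two points underlying `T p` differ by an element of `K₀`. A proper colouring for `K₀`
  -- therefore separates them, and finitely many colours suffice to order each `T p`.
  let K₀ : Finset Γ := (F * insert 1 S) * (F * insert 1 S)⁻¹
  have hK₀ : ∀ g ∈ K₀, g⁻¹ ∈ K₀ := by
    intro g hg
    obtain ⟨a, ha, b, hb, rfl⟩ := Finset.mem_mul.1 hg
    rw [mul_inv_rev]
    exact Finset.mul_mem_mul (Finset.mem_inv'.1 hb) (Finset.inv_mem_inv ha)
  obtain ⟨c₀, hc₀⟩ := exists_greedy_colouring (fun x : V => K₀.image (· • x)) (K₀.card + 1)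
    (fun x => Nat.lt_succ_of_le Finset.card_image_le) (by
      intro x y hy
      obtain ⟨g, hg, rfl⟩ := Finset.mem_image.1 hy
      exact Finset.mem_image.2 ⟨g⁻¹, hK₀ g hg, by simp⟩)
  -- Heights occurring in `T p` are below `F.card`, so the remainder changes nothing there; it only
  -- makes `c` total.
  let c : (Σ _ : V, ℕ) → Fin ((K₀.card + 1) * F.card) := fun l =>
    finProdFinEquiv (c₀ l.1, ⟨l.2 % F.card, Nat.mod_lt _ hFpos⟩)
  have hT {p : V} {l : Σ _ : V, ℕ} (hl : l ∈ T p) :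
      (∃ g ∈ F * insert 1 S, g • p = l.1) ∧ l.2 < F.card := by
    obtain ⟨σ, hσ, hl⟩ := Finset.mem_biUnion.1 hl
    obtain ⟨f, hf, hfl⟩ := exists_of_mem_layers hl
    exact ⟨⟨f * σ, Finset.mul_mem_mul hf hσ, by rw [mul_smul]; exact hfl⟩,
      snd_lt_of_mem_layers hl⟩
  have hc {p : V} : Set.InjOn c (T p) := by
    rintro ⟨z, j⟩ hl ⟨z', j'⟩ hl' he
    obtain ⟨⟨g, hg, rfl⟩, hj⟩ := hT hl
    obtain ⟨⟨g', hg', rfl⟩, hj'⟩ := hT hl'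
    have he2 := finProdFinEquiv.injective he
    simp only [Prod.mk.injEq, Fin.mk.injEq] at he2
    have h1 : g • p = g' • p := by
      by_contra hne
      refine hc₀ (g' • p) (g • p) (Finset.mem_image.2 ⟨g * g'⁻¹,
        Finset.mul_mem_mul hg (Finset.inv_mem_inv hg'), ?_⟩) hne he2.1
      simp [mul_smul]
    have h2 : j = j' := by
      simpa only [Nat.mod_eq_of_lt hj, Nat.mod_eq_of_lt hj'] using he2.2
    rw [h1, h2]
  have hIne (p : V) : (I p).Nonempty := by
    rw [← Finset.card_pos, card_layers]
    exact hFpos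
  have hbest (π : Equiv.Perm (Fin ((K₀.card + 1) * F.card))) (p : V) :
      ∃ l ∈ I p, ∀ l' ∈ I p, π (c l) ≤ π (c l') :=
    Finset.exists_min_image (I p) (fun l => π (c l)) (hIne p)
  choose best hbest_mem hbest_le using hbest
  refine ⟨Equiv.Perm (Fin ((K₀.card + 1) * F.card)), inferInstance, inferInstance,
    fun π => Setoid.ker (best π), F⁻¹ * F, ?_, ?_⟩
  · intro π x y hxy
    have hxy : best π x = best π y := hxy
    obtain ⟨f, hf, hfx⟩ := exists_of_mem_layers (hbest_mem π x)
    obtain ⟨f', hf', hfy⟩ := exists_of_mem_layers (hbest_mem π y)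
    refine ⟨f'⁻¹ * f, Finset.mul_mem_mul (Finset.inv_mem_inv hf') hf, ?_⟩
    rw [mul_smul, eq_inv_smul_iff, hfx, hxy, hfy]
  · intro p
    have hsub : (Finset.univ.filter fun π : Equiv.Perm (Fin ((K₀.card + 1) * F.card)) =>
        p ∈ bdry S (Setoid.ker (best π))) ⊆
        Finset.univ.filter fun π : Equiv.Perm (Fin ((K₀.card + 1) * F.card)) =>
          ∃ b ∈ (B p).image c, ∀ t ∈ (T p).image c, π b ≤ π t := by
      intro π hπ
      simp only [Finset.mem_filter, Finset.mem_univ, true_and] at hπ ⊢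
      obtain ⟨l, hl, hlmin⟩ := Finset.exists_min_image (T p) (fun l => π (c l))
        ((hIne p).mono (hTI1 p))
      refine ⟨c l, Finset.mem_image_of_mem c ?_, ?_⟩
      -- If the first element of `T p` is outside `B p`, it belongs to the multisets of `p` and of
      -- all its neighbours. It is then the choice of all of them, and `p` is not on the boundary.
      · by_contra hlB
        have hlall (σ : Γ) (hσ : σ ∈ insert 1 S) : l ∈ I (σ • p) := by
          obtain ⟨τ, hτ, hlτ⟩ := Finset.mem_biUnion.1 hl
          have hB (σ : Γ) (hσ : σ ∈ S) : l ∈ I p ↔ l ∈ I (σ • p) := by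
            by_contra hne
            refine hlB (Finset.mem_biUnion.2 ⟨σ, hσ, ?_⟩)
            simp only [Finset.mem_union, Finset.mem_sdiff]
            tauto
          have hlp : l ∈ I p := by
            rcases Finset.mem_insert.1 hτ with rfl | hτ
            · simpa using hlτ
            · exact (hB τ hτ).2 hlτ
          rcases Finset.mem_insert.1 hσ with rfl | hσ
          · simpa using hlp
          · exact (hB σ hσ).1 hlp
        have hbl (σ : Γ) (hσ : σ ∈ insert 1 S) : best π (σ • p) = l := by
          have h1 := hTI hσ (hbest_mem π (σ • p))
          exact hc h1 hl (π.injective (le_antisymm (hbest_le π _ l (hlall σ hσ)) (hlmin _ h1)))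
        obtain ⟨σ, hσ, hne⟩ := hπ
        apply hne
        change best π p = best π (σ • p)
        have h1 := hbl 1 (Finset.mem_insert_self _ _)
        rw [one_smul] at h1
        rw [h1, hbl σ (Finset.mem_insert_of_mem hσ)]
      · intro t ht
        obtain ⟨l', hl', rfl⟩ := Finset.mem_image.1 ht
        exact hlmin l' hl'
    have h1 : (Finset.univ.filter fun π : Equiv.Perm (Fin ((K₀.card + 1) * F.card)) =>
          ∃ b ∈ (B p).image c, ∀ t ∈ (T p).image c, π b ≤ π t).card * (T p).card ≤
        ((B p).image c).card * Fintype.card (Equiv.Perm (Fin ((K₀.card + 1) * F.card))) := by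
      have := card_perm_min_mem_mul_le (Finset.image_subset_image (f := c) (hBT p))
      rw [Finset.card_image_of_injOn hc] at this
      convert this
    have h2 : F.card ≤ (T p).card := by
      have := Finset.card_le_card (hTI1 p)
      rwa [card_layers] at this
    have h3 : ((Finset.univ.filter fun π : Equiv.Perm (Fin ((K₀.card + 1) * F.card)) =>
        p ∈ bdry S (Setoid.ker (best π))).card : ℝ) * F.card ≤
        (B p).card * Fintype.card (Equiv.Perm (Fin ((K₀.card + 1) * F.card))) := by
      have h4 := (Nat.mul_le_mul (Finset.card_le_card hsub) h2).trans
        (h1.trans (Nat.mul_le_mul_right _ Finset.card_image_le))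
      exact_mod_cast h4
    have hFpos' : (0 : ℝ) < F.card := by exact_mod_cast hFpos
    refine le_of_mul_le_mul_right (h3.trans ?_) hFpos'
    calc _ ≤ δ * F.card * Fintype.card (Equiv.Perm (Fin ((K₀.card + 1) * F.card))) :=
          mul_le_mul_of_nonneg_right (hBcard p) (by positivity)
      _ = _ := by ring

end Partitions

/-! ### Partitions with locally minimal boundary -/

section Minimal

variable {Γ V : Type*} [Group Γ] [MulAction Γ V]

/-- The partition that coincides with `q` on `W` and with `p` outside of `W`, and that cuts all
classes along `W`. -/
def cutPaste (W : Set V) (q p : Setoid V) : Setoid V where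
  r x y := (x ∈ W ∧ y ∈ W ∧ q x y) ∨ (x ∉ W ∧ y ∉ W ∧ p x y)
  iseqv := by
    refine ⟨fun x => ?_, fun {x y} h => ?_, fun {x y z} h h' => ?_⟩
    · by_cases hx : x ∈ W
      · exact Or.inl ⟨hx, hx, q.refl x⟩
      · exact Or.inr ⟨hx, hx, p.refl x⟩
    · rcases h with ⟨h1, h2, h3⟩ | ⟨h1, h2, h3⟩
      · exact Or.inl ⟨h2, h1, q.symm h3⟩
      · exact Or.inr ⟨h2, h1, p.symm h3⟩
    · rcases h with ⟨h1, h2, h3⟩ | ⟨h1, h2, h3⟩ <;> rcases h' with ⟨h4, h5, h6⟩ | ⟨h4, h5, h6⟩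
      · exact Or.inl ⟨h1, h5, q.trans h3 h6⟩
      · exact absurd h2 h4
      · exact absurd h4 h2
      · exact Or.inr ⟨h1, h5, p.trans h3 h6⟩

theorem BoundedBy.cutPaste {K : Finset Γ} {q p : Setoid V} (hq : BoundedBy K q)
    (hp : BoundedBy K p) (W : Set V) : BoundedBy K (cutPaste W q p) := by
  rintro x y (⟨-, -, h⟩ | ⟨-, -, h⟩)
  exacts [hq x y h, hp x y h]

open Classical in
/-- The points that some `σ ∈ S` moves into `W` or out of `W`. -/
noncomputable def edgeBdry (S : Finset Γ) (W : Finset V) : Finset V :=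
  S.biUnion fun σ => (W \ W.image (σ⁻¹ • ·)) ∪ (W.image (σ⁻¹ • ·) \ W)

theorem mem_edgeBdry {S : Finset Γ} {W : Finset V} {x : V} :
    x ∈ edgeBdry S W ↔ ∃ σ ∈ S, ¬ (x ∈ W ↔ σ • x ∈ W) := by
  classical
  have h (σ : Γ) : x ∈ W.image (σ⁻¹ • ·) ↔ σ • x ∈ W := by
    simp only [Finset.mem_image, inv_smul_eq_iff]
    exact ⟨by rintro ⟨a, ha, rfl⟩; exact ha, fun h => ⟨_, h, rfl⟩⟩
  simp only [edgeBdry, Finset.mem_biUnion, Finset.mem_union, Finset.mem_sdiff, h]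
  refine exists_congr fun σ => and_congr_right fun _ => ?_
  tauto

open Classical in
/-- There is a partition into `K`-bounded classes that no finite change improves. -/
theorem exists_minimal_partition (S K : Finset Γ) {s₀ : Setoid V} (hs₀ : BoundedBy K s₀) :
    ∃ p : Setoid V, BoundedBy K p ∧ ∀ (W : Finset V) (q : Setoid V), BoundedBy K q →
      (W.filter (· ∈ bdry S p)).card ≤ (W.filter (· ∈ bdry S q)).card + (edgeBdry S W).card := by
  have hmin (B : Finset V) : ∃ p : Setoid V, BoundedBy K p ∧ ∀ q : Setoid V, BoundedBy K q →
      (B.filter (· ∈ bdry S p)).card ≤ (B.filter (· ∈ bdry S q)).card := by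
    have hne : ∃ n, ∃ q : Setoid V, BoundedBy K q ∧ (B.filter (· ∈ bdry S q)).card = n :=
      ⟨_, s₀, hs₀, rfl⟩
    obtain ⟨p, hp, hpn⟩ := Nat.find_spec hne
    exact ⟨p, hp, fun q hq => hpn.trans_le (Nat.find_min' hne ⟨q, hq, rfl⟩)⟩
  choose P hPK hPmin using hmin
  -- The minimisers `P B` converge along an ultrafilter containing all sets of the form `{B | W ⊆
  -- B}`. A fixed finite part of the limit's boundary is already in the boundary of some `P B` with
  -- `W ⊆ B`.
  let 𝒰 : Ultrafilter (Finset V) := Ultrafilter.of Filter.atTop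
  let p : Setoid V :=
    { r := fun x y => ∀ᶠ B in (𝒰 : Filter (Finset V)), P B x y
      iseqv := ⟨fun x => Filter.Eventually.of_forall fun B => (P B).refl x,
        fun h => h.mono fun B hB => (P B).symm hB,
        fun h h' => (h.and h').mono fun B hB => (P B).trans hB.1 hB.2⟩ }
  refine ⟨p, fun x y hxy => ?_, fun W q hq => ?_⟩
  · have hxy : ∀ᶠ B in (𝒰 : Filter (Finset V)), P B x y := hxy
    obtain ⟨B, hB⟩ := hxy.exists
    exact hPK B x y hB
  · have h1 : ∀ᶠ B in (𝒰 : Filter (Finset V)), ∀ x ∈ W.filter (· ∈ bdry S p), x ∈ bdry S (P B) := by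
      rw [Filter.eventually_all_finset]
      intro x hx
      obtain ⟨σ, hσ, hne⟩ := (Finset.mem_filter.1 hx).2
      have hne : ¬ ∀ᶠ B in (𝒰 : Filter (Finset V)), P B x (σ • x) := hne
      rw [← Ultrafilter.eventually_not] at hne
      exact hne.mono fun B hB => ⟨σ, hσ, hB⟩
    have h2 : ∀ᶠ B in (𝒰 : Filter (Finset V)), W ⊆ B :=
      (Ultrafilter.of_le _) (Filter.eventually_ge_atTop W)
    obtain ⟨B, hB1, hWB⟩ := (h1.and h2).exists
    -- The competitor uses `q` inside `W` and `P B` outside; beyond the boundaries of these, it can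
    -- be cut only at `edgeBdry S W`.
    have h3 := hPmin B _ (hq.cutPaste (hPK B) (W : Set V))
    have h4 : B.filter (· ∈ bdry S (cutPaste (W : Set V) q (P B))) ⊆
        ((B \ W).filter (· ∈ bdry S (P B))) ∪
          (W.filter (· ∈ bdry S q) ∪ edgeBdry S W) := by
      intro x hx
      obtain ⟨hxB, σ, hσ, hne⟩ := Finset.mem_filter.1 hx
      simp only [Finset.mem_union, Finset.mem_filter, Finset.mem_sdiff]
      by_cases he : x ∈ edgeBdry S W
      · exact Or.inr (Or.inr he)
      have he' : x ∈ W ↔ σ • x ∈ W := by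
        by_contra hcon
        exact he (mem_edgeBdry.2 ⟨σ, hσ, hcon⟩)
      by_cases hxW : x ∈ W
      · exact Or.inr (Or.inl ⟨hxW, σ, hσ, fun h => hne (Or.inl ⟨hxW, he'.1 hxW, h⟩)⟩)
      · exact Or.inl ⟨⟨hxB, hxW⟩, σ, hσ, fun h => hne (Or.inr ⟨hxW, fun h' => hxW (he'.2 h'), h⟩)⟩
    have h5 : B.filter (· ∈ bdry S (P B)) =
        ((B \ W).filter (· ∈ bdry S (P B))) ∪ (W.filter (· ∈ bdry S (P B))) := by
      rw [← Finset.filter_union, Finset.sdiff_union_of_subset hWB]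
    have h6 : (B.filter (· ∈ bdry S (P B))).card =
        ((B \ W).filter (· ∈ bdry S (P B))).card + (W.filter (· ∈ bdry S (P B))).card := by
      rw [h5, Finset.card_union_of_disjoint]
      exact Finset.disjoint_filter_filter Finset.sdiff_disjoint
    have h7 : (W.filter (· ∈ bdry S p)).card ≤ (W.filter (· ∈ bdry S (P B))).card :=
      Finset.card_le_card fun x hx =>
        Finset.mem_filter.2 ⟨(Finset.mem_filter.1 hx).1, hB1 x hx⟩
    have h8 := (Finset.card_le_card h4).trans (Finset.card_union_le _ _)
    have h9 := Finset.card_union_le (W.filter (· ∈ bdry S q)) (edgeBdry S W)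
    omega

open Classical in
/-- There is a partition whose boundary has small density in all finite sets with small
boundary. -/
theorem exists_sparse_boundary (V : Type*) [MulAction Γ V] (h : IsAmenableGroup Γ)
    (S : Finset Γ) {δ : ℝ} (hδ : 0 < δ) :
    ∃ (p : Setoid V) (K : Finset Γ), BoundedBy K p ∧ ∀ W : Finset V,
      ((W.filter (· ∈ bdry S p)).card : ℝ) ≤ δ * W.card + (edgeBdry S W).card := by
  obtain ⟨ι, _, _, q, K, hK, hq⟩ := exists_partition_family V h S hδ
  obtain ⟨p, hp, hmin⟩ := exists_minimal_partition S K (hK (Classical.arbitrary ι))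
  refine ⟨p, K, hp, fun W => ?_⟩
  have hsum : ∑ i, ((W.filter (· ∈ bdry S (q i))).card : ℝ) ≤ ∑ _i : ι, δ * W.card := by
    calc ∑ i, ((W.filter (· ∈ bdry S (q i))).card : ℝ)
        = ∑ x ∈ W, ((Finset.univ.filter fun i => x ∈ bdry S (q i)).card : ℝ) := by
          have := Finset.sum_card_bipartiteAbove_eq_sum_card_bipartiteBelow
            (s := (Finset.univ : Finset ι)) (t := W) (fun i x => x ∈ bdry S (q i))
          exact_mod_cast this
      _ ≤ ∑ _x ∈ W, δ * Fintype.card ι := Finset.sum_le_sum fun x _ => hq x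
      _ = ∑ _i : ι, δ * W.card := by
          simp only [Finset.sum_const, nsmul_eq_mul, Finset.card_univ]
          ring
  -- Averaging over the random partition yields a good competitor on `W`. It depends on `W`, whereas
  -- `p` does not.
  obtain ⟨i, -, hi⟩ := Finset.exists_le_of_sum_le Finset.univ_nonempty hsum
  have h1 : ((W.filter (· ∈ bdry S p)).card : ℝ) ≤
      (W.filter (· ∈ bdry S (q i))).card + (edgeBdry S W).card := by
    exact_mod_cast hmin W (q i) (hK i)
  linarith

end Minimal

/-! ### Density of boundary points and of non-Følner classes -/

section Density

variable {Γ V : Type*} [Group Γ] [MulAction Γ V]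

/-- On the way from a point of `D` to a point outside of `D` there is a point of `D` from which a
generator leads out of `D`. -/
theorem exists_exit {S : Finset Γ} (hsymm : ∀ σ ∈ S, σ⁻¹ ∈ S)
    (hgen : Subgroup.closure (S : Set Γ) = ⊤) (V : Type*) [MulAction Γ V] (K : Finset Γ) :
    ∃ K' : Finset Γ, ∀ (D : Set V), ∀ x ∈ D, ∀ k ∈ K, k • x ∉ D →
      ∃ k' ∈ K', k' • x ∈ D ∧ ∃ σ ∈ S, σ • k' • x ∉ D := by
  classical
  have key (k : Γ) : ∃ K' : Finset Γ, ∀ (D : Set V), ∀ x ∈ D, k • x ∉ D →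
      ∃ k' ∈ K', k' • x ∈ D ∧ ∃ σ ∈ S, σ • k' • x ∉ D := by
    have hk : k ∈ Subgroup.closure (S : Set Γ) := hgen ▸ Subgroup.mem_top k
    induction hk using Subgroup.closure_induction with
    | mem k hk =>
      exact ⟨{1}, fun D x hx hkx => ⟨1, by simp, by simpa using hx, k, hk, by simpa using hkx⟩⟩
    | one => exact ⟨∅, fun D x hx hkx => absurd hx (by simpa using hkx)⟩
    | mul k l _ _ ihk ihl =>
      obtain ⟨K₁, hK₁⟩ := ihk
      obtain ⟨K₂, hK₂⟩ := ihl
      refine ⟨K₁.image (· * l) ∪ K₂, fun D x hx hkx => ?_⟩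
      by_cases hl : l • x ∈ D
      · obtain ⟨k', hk', h1, h2⟩ := hK₁ D (l • x) hl (by rwa [← mul_smul])
        refine ⟨k' * l, Finset.mem_union_left _ (Finset.mem_image_of_mem _ hk'), ?_⟩
        simpa only [mul_smul] using ⟨h1, h2⟩
      · obtain ⟨k', hk', h1⟩ := hK₂ D x hx hl
        exact ⟨k', Finset.mem_union_right _ hk', h1⟩
    | inv k _ ih =>
      obtain ⟨K₁, hK₁⟩ := ih
      -- The exit from `Dᶜ` on the way from `k⁻¹ • x` to `x` is an edge entering `D`; reversed, it
      -- is the required exit from `D`.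
      refine ⟨(S * K₁).image (· * k⁻¹), fun D x hx hkx => ?_⟩
      obtain ⟨k', hk', h1, σ, hσ, h2⟩ := hK₁ Dᶜ (k⁻¹ • x) hkx (by simpa using hx)
      refine ⟨σ * k' * k⁻¹, Finset.mem_image_of_mem _ (Finset.mul_mem_mul hσ hk'), ?_,
        σ⁻¹, hsymm σ hσ, ?_⟩
      · simpa only [mul_smul, Set.mem_compl_iff, not_not] using h2
      · simpa only [mul_smul, inv_smul_smul, Set.mem_compl_iff] using h1
  choose K' hK' using key
  refine ⟨K.biUnion K', fun D x hx k hk hkx => ?_⟩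
  obtain ⟨k', hk', h⟩ := hK' k D x hx hkx
  exact ⟨k', Finset.mem_biUnion.2 ⟨k, hk, hk'⟩, h⟩

open Classical in
/-- The class of `x` in a partition with `K`-bounded classes. -/
noncomputable def cell (K : Finset Γ) (p : Setoid V) (x : V) : Finset V :=
  (K.image (· • x)).filter fun y => p x y

theorem BoundedBy.mem_cell {K : Finset Γ} {p : Setoid V} (hp : BoundedBy K p) {x y : V} :
    y ∈ cell K p x ↔ p x y := by
  classical
  rw [cell, Finset.mem_filter, and_iff_right_iff_imp, Finset.mem_image]
  intro h
  obtain ⟨k, hk, rfl⟩ := hp x y h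
  exact ⟨k, hk, rfl⟩

theorem BoundedBy.self_mem_cell {K : Finset Γ} {p : Setoid V} (hp : BoundedBy K p) (x : V) :
    x ∈ cell K p x := hp.mem_cell.2 (p.refl x)

theorem BoundedBy.cell_eq {K : Finset Γ} {p : Setoid V} (hp : BoundedBy K p) {x y : V}
    (h : p x y) : cell K p x = cell K p y := by
  ext z
  rw [hp.mem_cell, hp.mem_cell]
  exact ⟨fun h' => p.trans (p.symm h) h', fun h' => p.trans h h'⟩

theorem card_cell_le (K : Finset Γ) (p : Setoid V) (x : V) : (cell K p x).card ≤ K.card := by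
  classical
  exact (Finset.card_filter_le _ _).trans Finset.card_image_le

open Classical in
/-- The number of boundary points in the class of `x`. -/
noncomputable def bdryCard (S K : Finset Γ) (p : Setoid V) (x : V) : ℕ :=
  ((cell K p x).filter (· ∈ bdry S p)).card

/-- The boundary points of `p` together with the points in classes that are not `ε`-Følner. -/
def excSet (S K : Finset Γ) (ε : ℝ) (p : Setoid V) : Set V :=
  {x | x ∈ bdry S p ∨ ε * (cell K p x).card < bdryCard S K p x}

-- Each non-Følner class contained in `W` has at most `ε⁻¹` times as many points as boundary points.
-- A class that meets `W` without being contained in it is bounded, so its points in `W` lie at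
-- bounded distance from the edge boundary of `W`.
open Classical in
theorem exists_card_excSet_le {S : Finset Γ} (hsymm : ∀ σ ∈ S, σ⁻¹ ∈ S)
    (hgen : Subgroup.closure (S : Set Γ) = ⊤) {K : Finset Γ} {p : Setoid V} (hp : BoundedBy K p)
    {ε : ℝ} (hε : 0 < ε) :
    ∃ C : ℕ, ∀ W : Finset V, ((W.filter (· ∈ excSet S K ε p)).card : ℝ) ≤
      (1 + ε⁻¹) * (W.filter (· ∈ bdry S p)).card + C * (edgeBdry S W).card := by
  obtain ⟨K', hK'⟩ := exists_exit hsymm hgen V K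
  refine ⟨K'.card, fun W => ?_⟩
  let G : Finset V := W.filter fun x =>
    cell K p x ⊆ W ∧ ε * (cell K p x).card < bdryCard S K p x
  let Y : Finset V := K'.biUnion fun k => (edgeBdry S W).image (k⁻¹ • ·)
  have hsub : W.filter (· ∈ excSet S K ε p) ⊆ W.filter (· ∈ bdry S p) ∪ (G ∪ Y) := by
    intro x hx
    obtain ⟨hxW, hx⟩ := Finset.mem_filter.1 hx
    simp only [Finset.mem_union]
    rcases hx with hx | hx
    · exact Or.inl (Finset.mem_filter.2 ⟨hxW, hx⟩)
    by_cases hcW : cell K p x ⊆ W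
    · exact Or.inr (Or.inl (Finset.mem_filter.2 ⟨hxW, hcW, hx⟩))
    · obtain ⟨y, hy, hyW⟩ := Finset.not_subset.1 hcW
      obtain ⟨k, hk, rfl⟩ := hp x y (hp.mem_cell.1 hy)
      obtain ⟨k', hk', h1, σ, hσ, h2⟩ := hK' (W : Set V) x hxW k hk hyW
      refine Or.inr (Or.inr (Finset.mem_biUnion.2 ⟨k', hk', Finset.mem_image.2
        ⟨k' • x, mem_edgeBdry.2 ⟨σ, hσ, fun h => h2 (h.1 h1)⟩, inv_smul_smul _ _⟩⟩))
  have hY : (Y.card : ℝ) ≤ K'.card * (edgeBdry S W).card := by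
    exact_mod_cast Finset.card_biUnion_le_card_mul _ _ _ fun k _ => Finset.card_image_le
  have hG : ε * G.card ≤ (W.filter (· ∈ bdry S p)).card := by
    let π : V → Quotient p := fun x => Quotient.mk p x
    have hfib (x : V) (hx : x ∈ G) : (G.filter fun y => π y = π x) = cell K p x := by
      ext y
      rw [Finset.mem_filter, hp.mem_cell]
      constructor
      · rintro ⟨-, h⟩
        exact p.symm (Quotient.exact h)
      · intro h
        refine ⟨?_, Quotient.sound (p.symm h)⟩
        obtain ⟨-, h1, h2⟩ := Finset.mem_filter.1 hx
        refine Finset.mem_filter.2 ⟨h1 (hp.mem_cell.2 h), ?_⟩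
        have hb : bdryCard S K p y = bdryCard S K p x := by
          rw [bdryCard, bdryCard, hp.cell_eq h]
        rw [hb, ← hp.cell_eq h]
        exact ⟨h1, h2⟩
    have h1 : (G.card : ℝ) = ∑ D ∈ G.image π, ((G.filter fun y => π y = D).card : ℝ) := by
      exact_mod_cast Finset.card_eq_sum_card_image π G
    have h2 : ((G.filter (· ∈ bdry S p)).card : ℝ) =
        ∑ D ∈ G.image π, (((G.filter (· ∈ bdry S p)).filter fun y => π y = D).card : ℝ) := by
      exact_mod_cast Finset.card_eq_sum_card_fiberwise fun x hx =>
        Finset.mem_image_of_mem π (Finset.mem_filter.1 hx).1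
    have h3 : ε * G.card ≤ (G.filter (· ∈ bdry S p)).card := by
      rw [h1, h2, Finset.mul_sum]
      refine Finset.sum_le_sum fun D hD => ?_
      obtain ⟨x, hx, rfl⟩ := Finset.mem_image.1 hD
      rw [hfib x hx, Finset.filter_comm, hfib x hx]
      exact (Finset.mem_filter.1 hx).2.2.le
    refine h3.trans ?_
    exact_mod_cast Finset.card_le_card (Finset.filter_subset_filter _ (Finset.filter_subset _ _))
  have hG' : (G.card : ℝ) ≤ ε⁻¹ * (W.filter (· ∈ bdry S p)).card := by
    rw [← div_eq_inv_mul, le_div_iff₀ hε]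
    linarith
  have h1 : ((W.filter (· ∈ excSet S K ε p)).card : ℝ) ≤
      (W.filter (· ∈ bdry S p)).card + (G.card + Y.card) := by
    exact_mod_cast (Finset.card_le_card hsub).trans ((Finset.card_union_le _ _).trans
      (Nat.add_le_add_left (Finset.card_union_le _ _) _))
  linarith

end Density

/-! ### Sparsity of the exceptional set seen from every point -/

section Sparse

open Classical in
/-- The layer of height `j` of a set of points of `V × ℕ`. -/
noncomputable def slice {V : Type*} (L : Finset (Σ _ : V, ℕ)) (j : ℕ) : Finset V :=
  (L.filter fun l => l.2 = j).image Sigma.fst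

theorem mem_slice {V : Type*} {L : Finset (Σ _ : V, ℕ)} {j : ℕ} {z : V} :
    z ∈ slice L j ↔ (⟨z, j⟩ : Σ _ : V, ℕ) ∈ L := by
  classical
  simp only [slice, Finset.mem_image, Finset.mem_filter]
  constructor
  · rintro ⟨⟨z, j⟩, ⟨h, rfl⟩, rfl⟩
    exact h
  · exact fun h => ⟨_, ⟨h, rfl⟩, rfl⟩

theorem sum_card_slice {V : Type*} {L : Finset (Σ _ : V, ℕ)} {n : ℕ} (hL : ∀ l ∈ L, l.2 < n) :
    ∑ j ∈ Finset.range n, (slice L j).card = L.card := by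
  classical
  rw [Finset.card_eq_sum_card_fiberwise (f := Sigma.snd) (t := Finset.range n)
    fun l hl => Finset.mem_coe.2 (Finset.mem_range.2 (hL l hl))]
  refine Finset.sum_congr rfl fun j _ => Finset.card_image_of_injOn ?_
  rintro ⟨z, i⟩ hz ⟨z', i'⟩ hz' h
  obtain ⟨-, rfl⟩ := Finset.mem_filter.1 hz
  obtain ⟨-, h2⟩ := Finset.mem_filter.1 hz'
  simp only at h h2
  rw [h, h2]

variable {Γ V : Type*} [Group Γ] [MulAction Γ V]

open Classical in
theorem slice_layers_image_smul {α : Type*} (I : Finset α) (u : α → V) (g : Γ) (j : ℕ) :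
    (slice (layers I u) j).image (g • ·) = slice (layers I (fun i => g • u i)) j := by
  ext z
  simp only [Finset.mem_image, mem_slice, mem_layers]
  constructor
  · rintro ⟨y, hy, rfl⟩
    simpa using hy
  · intro h
    refine ⟨g⁻¹ • z, ?_, smul_inv_smul g z⟩
    simpa only [eq_inv_smul_iff] using h

open Classical in
/-- There is a partition `p` such that a suitable symmetric random element of the group moves
each point into the exceptional set of `p` with small probability only. -/
theorem exists_sparse_excSet (V : Type*) [MulAction Γ V] (h : IsAmenableGroup Γ)
    {S : Finset Γ} (hsymm : ∀ σ ∈ S, σ⁻¹ ∈ S) (hgen : Subgroup.closure (S : Set Γ) = ⊤)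
    {ε η : ℝ} (hε : 0 < ε) (hη : 0 < η) :
    ∃ (p : Setoid V) (K E : Finset Γ), BoundedBy K p ∧ E.Nonempty ∧ ∀ x : V,
      (((E ×ˢ E).filter fun i => (i.2⁻¹ * i.1) • x ∈ excSet S K ε p).card : ℝ) ≤
        η * (E ×ˢ E).card := by
  obtain ⟨p, K, hp, hpW⟩ := exists_sparse_boundary V h S (δ := η / (2 * (1 + ε⁻¹)))
    (by positivity)
  obtain ⟨C, hC⟩ := exists_card_excSet_le hsymm hgen hp hε
  -- One half of `η` pays for the boundary density of `p`. The other half pays for the edge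
  -- boundaries of the slices, which enter with total factor `R`.
  set R : ℝ := (1 + ε⁻¹ + C) * (2 * (S.card + 1)) with hR
  have hRpos : 0 < R := by positivity
  obtain ⟨E, hE, hEF⟩ := h.exists_folner S (δ := η / 2 / R) (by positivity)
  refine ⟨p, K, E, hp, hE, fun x => ?_⟩
  -- The counting function of `u` is the sum of the indicators of its slices, so the estimates for
  -- finite sets `W` apply slice by slice.
  let u : Γ × Γ → V := fun i => (i.2⁻¹ * i.1) • x
  set I : Finset (Γ × Γ) := E ×ˢ E with hI
  have hlt (l : Σ _ : V, ℕ) (hl : l ∈ layers I u) : l.2 < I.card := snd_lt_of_mem_layers hl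
  have hX : ∑ j ∈ Finset.range I.card,
      ((slice (layers I u) j).filter (· ∈ excSet S K ε p)).card =
      (I.filter fun i => u i ∈ excSet S K ε p).card := by
    rw [← card_layers_filter, ← sum_card_slice (n := I.card)
      fun l hl => hlt l (Finset.mem_filter.1 hl).1]
    refine Finset.sum_congr rfl fun j _ => congrArg _ ?_
    ext z
    simp only [Finset.mem_filter, mem_slice]
  have hslice : ∑ j ∈ Finset.range I.card, (slice (layers I u) j).card = I.card := by
    rw [sum_card_slice hlt, card_layers]
  have hdiff (I₁ I₂ : Finset (Γ × Γ)) (h₁ : I₁.card ≤ I.card) :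
      ∑ j ∈ Finset.range I.card, (slice (layers I₁ u) j \ slice (layers I₂ u) j).card ≤
        (I₁ \ I₂).card := by
    refine le_trans (le_of_eq ?_) (card_layers_sdiff_le I₁ I₂ u)
    rw [← sum_card_slice (n := I.card)
      fun l hl => (snd_lt_of_mem_layers (Finset.mem_sdiff.1 hl).1).trans_le h₁]
    refine Finset.sum_congr rfl fun j _ => congrArg _ ?_
    ext z
    simp only [Finset.mem_sdiff, mem_slice]
  -- Since `σ⁻¹ * i.2⁻¹ = (i.2 * σ)⁻¹`, moving the points by `σ⁻¹` amounts to replacing the second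
  -- factor `E` by its right translate.
  have hσ (σ : Γ) (j : ℕ) : (slice (layers I u) j).image (σ⁻¹ • ·) =
      slice (layers (E ×ˢ E.image (· * σ)) u) j := by
    have hinj : Function.Injective (Prod.map id (· * σ) : Γ × Γ → Γ × Γ) :=
      Function.injective_id.prodMap (mul_left_injective σ)
    have himg : E ×ˢ E.image (· * σ) = I.image (Prod.map id (· * σ)) := by
      rw [hI, Finset.prodMap_image_product, Finset.image_id]
    rw [slice_layers_image_smul, himg, layers_image hinj]
    congr 2
    funext i
    simp [u, mul_smul]
  have hcard (σ : Γ) : (E ×ˢ E.image (· * σ)).card ≤ I.card := by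
    rw [Finset.card_product, hI, Finset.card_product]
    exact Nat.mul_le_mul_left _ Finset.card_image_le
  have hedge : (∑ j ∈ Finset.range I.card, (edgeBdry S (slice (layers I u) j)).card : ℝ) ≤
      2 * (S.card + 1) * (η / 2 / R * I.card) := by
    have hprod (A B : Finset Γ) : (E ×ˢ A) \ (E ×ˢ B) = E ×ˢ (A \ B) := by
      ext i
      simp only [Finset.mem_sdiff, Finset.mem_product]
      tauto
    have hσ2 (σ : Γ) (hσS : σ ∈ S) : (∑ j ∈ Finset.range I.card,
        ((slice (layers I u) j \ (slice (layers I u) j).image (σ⁻¹ • ·)) ∪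
          ((slice (layers I u) j).image (σ⁻¹ • ·) \ slice (layers I u) j)).card : ℝ) ≤
        2 * (η / 2 / R * I.card) := by
      have h1 : ((I \ (E ×ˢ E.image (· * σ))).card : ℝ) ≤ η / 2 / R * I.card := by
        rw [hI, hprod, Finset.card_product, Finset.card_product]
        push_cast
        nlinarith [(hEF σ hσS).2, (Nat.cast_nonneg E.card : (0 : ℝ) ≤ E.card)]
      have h2 : (((E ×ˢ E.image (· * σ)) \ I).card : ℝ) ≤ η / 2 / R * I.card := by
        rw [hI, hprod, Finset.card_product, Finset.card_product]
        push_cast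
        nlinarith [(hEF σ hσS).1, (Nat.cast_nonneg E.card : (0 : ℝ) ≤ E.card)]
      have h3 := hdiff I (E ×ˢ E.image (· * σ)) le_rfl
      have h4 := hdiff (E ×ˢ E.image (· * σ)) I (hcard σ)
      have h5 : ∑ j ∈ Finset.range I.card,
          ((slice (layers I u) j \ (slice (layers I u) j).image (σ⁻¹ • ·)) ∪
            ((slice (layers I u) j).image (σ⁻¹ • ·) \ slice (layers I u) j)).card ≤
          (I \ (E ×ˢ E.image (· * σ))).card + ((E ×ˢ E.image (· * σ)) \ I).card := by
        refine le_trans ?_ (Nat.add_le_add h3 h4)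
        rw [← Finset.sum_add_distrib]
        refine Finset.sum_le_sum fun j _ => ?_
        rw [hσ]
        exact Finset.card_union_le _ _
      have h6 : (∑ j ∈ Finset.range I.card,
          ((slice (layers I u) j \ (slice (layers I u) j).image (σ⁻¹ • ·)) ∪
            ((slice (layers I u) j).image (σ⁻¹ • ·) \ slice (layers I u) j)).card : ℝ) ≤
          (I \ (E ×ˢ E.image (· * σ))).card + ((E ×ˢ E.image (· * σ)) \ I).card := by
        exact_mod_cast h5
      linarith
    calc (∑ j ∈ Finset.range I.card, (edgeBdry S (slice (layers I u) j)).card : ℝ)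
        ≤ ∑ j ∈ Finset.range I.card, ∑ σ ∈ S,
          (((slice (layers I u) j \ (slice (layers I u) j).image (σ⁻¹ • ·)) ∪
            ((slice (layers I u) j).image (σ⁻¹ • ·) \ slice (layers I u) j)).card : ℝ) := by
          refine Finset.sum_le_sum fun j _ => ?_
          exact_mod_cast Finset.card_biUnion_le
      _ ≤ ∑ _σ ∈ S, 2 * (η / 2 / R * I.card) := by
          rw [Finset.sum_comm]
          exact Finset.sum_le_sum hσ2
      _ = S.card * (2 * (η / 2 / R * I.card)) := by rw [Finset.sum_const, nsmul_eq_mul]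
      _ ≤ 2 * (S.card + 1) * (η / 2 / R * I.card) := by
          have : 0 ≤ η / 2 / R * I.card := by positivity
          nlinarith
  have hj (j : ℕ) : (((slice (layers I u) j).filter (· ∈ excSet S K ε p)).card : ℝ) ≤
      η / 2 * (slice (layers I u) j).card +
        (1 + ε⁻¹ + C) * (edgeBdry S (slice (layers I u) j)).card := by
    have h1 := hC (slice (layers I u) j)
    have h2 := mul_le_mul_of_nonneg_left (hpW (slice (layers I u) j))
      (by positivity : 0 ≤ 1 + ε⁻¹)
    have h3 : (1 + ε⁻¹) * (η / (2 * (1 + ε⁻¹))) = η / 2 := by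
      have : 1 + ε⁻¹ ≠ 0 := by positivity
      field_simp
    rw [mul_add, ← mul_assoc, h3] at h2
    linarith
  calc ((I.filter fun i => u i ∈ excSet S K ε p).card : ℝ)
      = ∑ j ∈ Finset.range I.card,
        (((slice (layers I u) j).filter (· ∈ excSet S K ε p)).card : ℝ) := by
        exact_mod_cast hX.symm
    _ ≤ ∑ j ∈ Finset.range I.card, (η / 2 * (slice (layers I u) j).card +
        (1 + ε⁻¹ + C) * (edgeBdry S (slice (layers I u) j)).card) :=
        Finset.sum_le_sum fun j _ => hj j
    _ = η / 2 * I.card + (1 + ε⁻¹ + C) *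
        ∑ j ∈ Finset.range I.card, ((edgeBdry S (slice (layers I u) j)).card : ℝ) := by
        rw [Finset.sum_add_distrib, ← Finset.mul_sum, ← Finset.mul_sum]
        congr 2
        exact_mod_cast hslice
    _ ≤ η / 2 * I.card + (1 + ε⁻¹ + C) * (2 * (S.card + 1) * (η / 2 / R * I.card)) := by
        gcongr
    _ = η / 2 * I.card + R * (η / 2 / R) * I.card := by rw [hR]; ring
    _ = η * I.card := by
        rw [mul_div_cancel₀ _ hRpos.ne']
        ring

end Sparse

/-! ### Distributing bad classes by Hall's theorem -/

section Assignment

variable {Γ V : Type*} [Group Γ] [MulAction Γ V]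

open Classical in
/-- A finite part `A` of a sparse set `X` has many neighbours outside of `X`. -/
theorem card_le_card_neighbours_of_sparse {X : Set V} {E : Finset Γ} {η : ℝ} (hE : E.Nonempty)
    (hX : ∀ x : V, (((E ×ˢ E).filter fun i => (i.2⁻¹ * i.1) • x ∈ X).card : ℝ) ≤
      η * (E ×ˢ E).card) (A : Finset V) (hA : ∀ a ∈ A, a ∈ X) :
    (1 - η) * A.card ≤ η * ((A.biUnion fun a =>
      (E ×ˢ E).image fun i => (i.2⁻¹ * i.1) • a).filter (· ∉ X)).card := by
  set I : Finset (Γ × Γ) := E ×ˢ E with hI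
  set Y := (A.biUnion fun a => I.image fun i => (i.2⁻¹ * i.1) • a).filter (· ∉ X) with hY
  have hIpos : (0 : ℝ) < I.card := by exact_mod_cast (hE.product hE).card_pos
  have h1 : (A.sigma fun a => I.filter fun i => (i.2⁻¹ * i.1) • a ∉ X).card ≤
      (Y.sigma fun y => I.filter fun i => (i.2⁻¹ * i.1) • y ∈ X).card := by
    -- Double counting of the pairs leading from `A` out of `X`: swapping the coordinates of `i`
    -- inverts `i.2⁻¹ * i.1` and leads back.
    refine Finset.card_le_card_of_injOn
      (fun w => ⟨(w.2.2⁻¹ * w.2.1) • w.1, w.2.swap⟩) ?_ ?_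
    · rintro ⟨a, i⟩ hw
      obtain ⟨ha, hi⟩ := Finset.mem_sigma.1 hw
      obtain ⟨hiI, hi⟩ := Finset.mem_filter.1 hi
      refine Finset.mem_sigma.2 ⟨Finset.mem_filter.2 ⟨Finset.mem_biUnion.2
        ⟨a, ha, Finset.mem_image_of_mem _ hiI⟩, hi⟩, Finset.mem_filter.2 ⟨?_, ?_⟩⟩
      · obtain ⟨h1, h2⟩ := Finset.mem_product.1 hiI
        exact Finset.mem_product.2 ⟨h2, h1⟩
      · simpa [← mul_smul, mul_assoc] using hA a ha
    · rintro ⟨a, i, j⟩ _ ⟨a', i', j'⟩ _ h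
      simp only [Sigma.mk.injEq, Prod.swap_prod_mk, heq_eq_eq, Prod.mk.injEq] at h
      obtain ⟨h1, rfl, rfl⟩ := h
      rw [smul_left_cancel _ h1]
  have h2 : ((A.sigma fun a => I.filter fun i => (i.2⁻¹ * i.1) • a ∉ X).card : ℝ) ≥
      A.card * ((1 - η) * I.card) := by
    rw [Finset.card_sigma, ← nsmul_eq_mul]
    push_cast
    refine Finset.card_nsmul_le_sum _ _ _ fun a _ => ?_
    have h3 : ((I.filter fun i => (i.2⁻¹ * i.1) • a ∈ X).card : ℝ) +
        (I.filter fun i => (i.2⁻¹ * i.1) • a ∉ X).card = I.card := by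
      exact_mod_cast Finset.card_filter_add_card_filter_not _
    linarith [hX a]
  have h3 : ((Y.sigma fun y => I.filter fun i => (i.2⁻¹ * i.1) • y ∈ X).card : ℝ) ≤
      Y.card * (η * I.card) := by
    rw [Finset.card_sigma, ← nsmul_eq_mul]
    push_cast
    exact Finset.sum_le_card_nsmul _ _ _ fun y _ => hX y
  have h4 : ((A.sigma fun a => I.filter fun i => (i.2⁻¹ * i.1) • a ∉ X).card : ℝ) ≤
      (Y.sigma fun y => I.filter fun i => (i.2⁻¹ * i.1) • y ∈ X).card := by exact_mod_cast h1
  refine le_of_mul_le_mul_right ?_ hIpos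
  linarith

/-- The union of the classes of `q` that meet `X`. -/
def saturation (q : Setoid V) (X : Set V) : Set V := {x | ∃ x' ∈ X, q x x'}

theorem mem_saturation_congr {q : Setoid V} {X : Set V} {x y : V} (h : q x y) :
    x ∈ saturation q X ↔ y ∈ saturation q X :=
  ⟨fun ⟨z, hz, h'⟩ => ⟨z, hz, q.trans (q.symm h) h'⟩, fun ⟨z, hz, h'⟩ => ⟨z, hz, q.trans h h'⟩⟩

theorem subset_saturation (q : Setoid V) (X : Set V) : X ⊆ saturation q X :=
  fun x hx => ⟨x, hx, q.refl x⟩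

/-- The number of classes of `q` that a class of `p` may absorb. -/
noncomputable def capacity (K : Finset Γ) (p : Setoid V) (ε M : ℝ) (D : Quotient p) : ℕ :=
  ⌊ε * (cell K p D.out).card / (8 * M)⌋₊

theorem BoundedBy.cell_out {K : Finset Γ} {p : Setoid V} (hp : BoundedBy K p) (x : V) :
    cell K p (Quotient.mk p x).out = cell K p x := hp.cell_eq (Quotient.mk_out x)

open Classical in
/-- The classes of `q` that meet the sparse set `excSet S K ε' p` can be distributed among nearby
Følner classes of `p` such that no class of `p` exceeds its capacity. -/
theorem exists_assignment {S K E : Finset Γ} {p : Setoid V} {ε ε' η M : ℝ}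
    (hp : BoundedBy K p) (hE : E.Nonempty) (hbig : ∀ x, 1 ≤ bdryCard S K p x)
    (hX : ∀ x : V, (((E ×ˢ E).filter fun i => (i.2⁻¹ * i.1) • x ∈ excSet S K ε' p).card : ℝ) ≤
      η * (E ×ˢ E).card) (hM : 0 < M) (hη : 0 < η) (hε : 0 < ε)
    (hMε : 8 * M * ε' ≤ ε) (hMη : 16 * M * η ≤ ε * (1 - η)) (q : Setoid V) :
    ∃ g : V → Σ _ : Quotient p, ℕ,
      (∀ x ∈ saturation q (excSet S K ε' p), ∀ y ∈ saturation q (excSet S K ε' p),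
        q x y ↔ g x = g y) ∧
      ∀ x ∈ saturation q (excSet S K ε' p), (g x).2 < capacity K p ε M (g x).1 ∧
        ∃ x', q x x' ∧ ∃ i ∈ E ×ˢ E, (i.2⁻¹ * i.1) • x' ∉ excSet S K ε' p ∧
          Quotient.mk p ((i.2⁻¹ * i.1) • x') = (g x).1 := by
  set X := excSet S K ε' p with hXdef
  let C := {c : Quotient q // ∃ x ∈ X, Quotient.mk q x = c}
  choose rep hrepX hrep using fun c : C => c.2
  have hrepinj : Function.Injective rep := by
    intro c c' h
    exact Subtype.ext ((hrep c).symm.trans ((congrArg _ h).trans (hrep c')))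
  -- Each class of `q` meeting `X` looks for a free slot `(D, j)` in a Følner class `D` of `p` near
  -- its representative.
  let t : C → Finset (Σ _ : Quotient p, ℕ) := fun c =>
    ((((E ×ˢ E).image fun i => (i.2⁻¹ * i.1) • rep c).filter (· ∉ X)).image
      (Quotient.mk p)).sigma fun D => Finset.range (capacity K p ε M D)
  have hHall (𝒜 : Finset C) : 𝒜.card ≤ (𝒜.biUnion t).card := by
    let A : Finset V := 𝒜.image rep
    let Y : Finset V := (A.biUnion fun a =>
      (E ×ˢ E).image fun i => (i.2⁻¹ * i.1) • a).filter (· ∉ X)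
    have hAY : (1 - η) * A.card ≤ η * Y.card :=
      card_le_card_neighbours_of_sparse hE hX A (by
        intro a ha
        obtain ⟨c, -, rfl⟩ := Finset.mem_image.1 ha
        exact hrepX c)
    have hsub : ((Y.image (Quotient.mk p)).sigma fun D => Finset.range (capacity K p ε M D)) ⊆
        𝒜.biUnion t := by
      rintro ⟨D, j⟩ h
      obtain ⟨hD, hj⟩ := Finset.mem_sigma.1 h
      obtain ⟨y, hy, rfl⟩ := Finset.mem_image.1 hD
      obtain ⟨hy, hyX⟩ := Finset.mem_filter.1 hy
      obtain ⟨a, ha, hy⟩ := Finset.mem_biUnion.1 hy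
      obtain ⟨c, hc, rfl⟩ := Finset.mem_image.1 ha
      exact Finset.mem_biUnion.2 ⟨c, hc, Finset.mem_sigma.2
        ⟨Finset.mem_image_of_mem _ (Finset.mem_filter.2 ⟨hy, hyX⟩), hj⟩⟩
    have hYle : (Y.card : ℝ) ≤
        ∑ D ∈ Y.image (Quotient.mk p), ((cell K p D.out).card : ℝ) := by
      rw [Finset.card_eq_sum_card_image (Quotient.mk p) Y]
      push_cast
      refine Finset.sum_le_sum fun D _ => ?_
      exact_mod_cast Finset.card_le_card fun y hy => by
        rw [← (Finset.mem_filter.1 hy).2, hp.cell_out]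
        exact hp.self_mem_cell y
    -- A Følner class with at least one boundary point has at least `1 / ε'` points. The number
    -- inside the floor is then at least 1, and rounding down loses at most half of it.
    have hcap (D : Quotient p) (hD : D ∈ Y.image (Quotient.mk p)) :
        ε / (16 * M) * (cell K p D.out).card ≤ capacity K p ε M D := by
      obtain ⟨y, hy, rfl⟩ := Finset.mem_image.1 hD
      have hyX : y ∉ excSet S K ε' p := (Finset.mem_filter.1 hy).2
      simp only [excSet, Set.mem_ofPred_eq, not_or, not_lt] at hyX
      have hb : (1 : ℝ) ≤ bdryCard S K p y := by exact_mod_cast hbig y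
      have h1 : 1 ≤ ε' * (cell K p y).card := hb.trans hyX.2
      rw [capacity, hp.cell_out]
      have h2 : 1 ≤ ε * (cell K p y).card / (8 * M) := by
        rw [le_div_iff₀ (by positivity)]
        nlinarith [mul_le_mul_of_nonneg_right hMε (Nat.cast_nonneg (cell K p y).card : (0 : ℝ) ≤ _)]
      have h3 := Nat.lt_floor_add_one (ε * (cell K p y).card / (8 * M))
      have h4 : (1 : ℝ) ≤ ⌊ε * (cell K p y).card / (8 * M)⌋₊ := by
        exact_mod_cast Nat.floor_pos.2 h2
      have h5 : ε / (16 * M) * (cell K p y).card = ε * (cell K p y).card / (8 * M) / 2 := by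
        field_simp
        ring
      rw [h5]
      linarith
    have h1 : (∑ D ∈ Y.image (Quotient.mk p), (capacity K p ε M D : ℝ)) ≤ (𝒜.biUnion t).card := by
      have := Finset.card_le_card hsub
      rw [Finset.card_sigma] at this
      simp only [Finset.card_range] at this
      exact_mod_cast this
    have h2 : ε / (16 * M) * Y.card ≤ (𝒜.biUnion t).card := by
      refine le_trans ?_ h1
      refine le_trans (mul_le_mul_of_nonneg_left hYle (by positivity)) ?_
      rw [Finset.mul_sum]
      exact Finset.sum_le_sum hcap
    have h3 : (A.card : ℝ) ≤ ε / (16 * M) * Y.card := by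
      rw [div_mul_eq_mul_div, le_div_iff₀ (by positivity)]
      refine le_of_mul_le_mul_left ?_ hη
      nlinarith [mul_le_mul_of_nonneg_right hMη (Nat.cast_nonneg A.card : (0 : ℝ) ≤ _),
        mul_le_mul_of_nonneg_left hAY hε.le]
    have h4 : A.card = 𝒜.card := Finset.card_image_of_injective _ hrepinj
    rw [← h4]
    exact_mod_cast h3.trans h2
  obtain ⟨f, hf, hft⟩ := (Finset.all_card_le_biUnion_card_iff_exists_injective t).1 hHall
  have hC {x : V} (hx : x ∈ saturation q X) : ∃ x' ∈ X, Quotient.mk q x' = Quotient.mk q x := by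
    obtain ⟨x', hx', h⟩ := hx
    exact ⟨x', hx', Quotient.sound (q.symm h)⟩
  -- The value outside the saturation is arbitrary.
  refine ⟨fun x => if hx : x ∈ saturation q X then f ⟨Quotient.mk q x, hC hx⟩
    else ⟨Quotient.mk p x, 0⟩, fun x hx y hy => ?_, fun x hx => ?_⟩
  · simp only [dif_pos hx, dif_pos hy]
    rw [hf.eq_iff, Subtype.mk.injEq]
    exact ⟨fun h => Quotient.sound h, fun h => Quotient.exact h⟩
  · simp only [dif_pos hx]
    obtain ⟨h1, h2⟩ := Finset.mem_sigma.1 (hft ⟨Quotient.mk q x, hC hx⟩)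
    obtain ⟨y, hy, hyf⟩ := Finset.mem_image.1 h1
    obtain ⟨hy, hyX⟩ := Finset.mem_filter.1 hy
    obtain ⟨i, hi, rfl⟩ := Finset.mem_image.1 hy
    exact ⟨Finset.mem_range.1 h2, rep ⟨Quotient.mk q x, hC hx⟩,
      q.symm (Quotient.exact (hrep ⟨Quotient.mk q x, hC hx⟩)), i, hi, hyX, hyf⟩

end Assignment

/-! ### Modifying the random partition into Følner tilings -/

section Tiling

variable {Γ V : Type*} [Group Γ] [MulAction Γ V]

open Classical in
/-- A Følner class of `p` meets few classes of `q` that contain exceptional points. -/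
theorem exists_card_filter_saturation_le {S : Finset Γ} (hsymm : ∀ σ ∈ S, σ⁻¹ ∈ S)
    (hgen : Subgroup.closure (S : Set Γ) = ⊤) (V : Type*) [MulAction Γ V] (L : Finset Γ) :
    ∃ κ : ℕ, ∀ (q p : Setoid V) (K : Finset Γ) (ε : ℝ), BoundedBy L q → BoundedBy K p →
      ∀ z ∉ excSet S K ε p, ((cell K p z).filter
        (· ∈ saturation q (excSet S K ε p))).card ≤ κ * bdryCard S K p z := by
  obtain ⟨L', hL'⟩ := exists_exit hsymm hgen V L
  refine ⟨(L ∪ L').card, fun q p K ε hq hp z hz => ?_⟩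
  refine (Finset.card_le_card (t := (L ∪ L').biUnion fun k =>
    ((cell K p z).filter (· ∈ bdry S p)).image (k⁻¹ • ·)) ?_).trans
      (Finset.card_biUnion_le_card_mul _ _ _ fun k _ => Finset.card_image_le)
  intro x hx
  obtain ⟨hxz, x', hx'X, hxx'⟩ := Finset.mem_filter.1 hx
  have hpx : p z x := hp.mem_cell.1 hxz
  obtain ⟨k, hk, rfl⟩ := hq x x' hxx'
  have hmem (g : Γ) (hg : g ∈ L ∪ L') (h1 : p z (g • x)) (h2 : g • x ∈ bdry S p) :
      x ∈ (L ∪ L').biUnion fun k =>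
        ((cell K p z).filter (· ∈ bdry S p)).image (k⁻¹ • ·) :=
    Finset.mem_biUnion.2 ⟨g, hg, Finset.mem_image.2
      ⟨g • x, Finset.mem_filter.2 ⟨hp.mem_cell.2 h1, h2⟩, inv_smul_smul g x⟩⟩
  -- An exceptional point in the Følner class of `z` must be a boundary point. If the exceptional
  -- point lies in another class, the way to it leaves the class of `z` at a boundary point near
  -- `x`.
  by_cases h : p z (k • x)
  · refine hmem k (Finset.mem_union_left _ hk) h ?_
    rcases hx'X with h1 | h1
    · exact h1
    · refine absurd (Or.inr ?_) hz
      rwa [bdryCard, hp.cell_eq h]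
  · obtain ⟨k', hk', h1, σ, hσ, h2⟩ := hL' {y | p z y} x hpx k hk h
    exact hmem k' (Finset.mem_union_right _ hk') h1 ⟨σ, hσ, fun h3 => h2 (p.trans h1 h3)⟩

open Classical in
/-- If `p` has few exceptional points, any partition `q` with bounded classes can be modified
to a partition into Følner sets that has no further boundary points. -/
theorem exists_folner_partition {S K E L : Finset Γ} {p : Setoid V} {ε ε' η M : ℝ} {κ : ℕ}
    (hp : BoundedBy K p) (hE : E.Nonempty) (hbig : ∀ x, 1 ≤ bdryCard S K p x)
    (hX : ∀ x : V, (((E ×ˢ E).filter fun i => (i.2⁻¹ * i.1) • x ∈ excSet S K ε' p).card : ℝ) ≤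
      η * (E ×ˢ E).card) (hM : 0 < M) (hη : 0 < η) (hε : 0 < ε)
    (hMε : 8 * M * ε' ≤ ε) (hMη : 16 * M * η ≤ ε * (1 - η)) (hLM : (L.card : ℝ) ≤ M)
    (hκ : ∀ (q p : Setoid V) (K : Finset Γ) (ε : ℝ), BoundedBy L q → BoundedBy K p →
      ∀ z ∉ excSet S K ε p, ((cell K p z).filter
        (· ∈ saturation q (excSet S K ε p))).card ≤ κ * bdryCard S K p z)
    (hκ1 : κ * ε' ≤ 1 / 2) (hκ2 : S.card * (κ * ε') ≤ ε / 8) :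
    ∃ K' : Finset Γ, ∀ q : Setoid V, BoundedBy L q → ∃ t : Setoid V, BoundedBy K' t ∧
      bdry S t ⊆ bdry S q ∧ ∀ x, (bdryCard S K' t x : ℝ) < ε * (cell K' t x).card := by
  set X := excSet S K ε' p with hXdef
  let K₃ : Finset Γ := insert 1 ((E⁻¹ * E) * L)
  refine ⟨K₃⁻¹ * (K * K₃), fun q hq => ?_⟩
  obtain ⟨g, hg1, hg2⟩ := exists_assignment hp hE hbig hX hM hη hε hMε hMη q
  let W := saturation q X
  -- The new classes are the fibres of `τ`. Every value of `τ` is a Følner class of `p`, since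
  -- non-Følner classes lie in `X` and hence in `W`.
  let τ : V → Quotient p := fun x => if x ∈ W then (g x).1 else Quotient.mk p x
  have hτW {x : V} (hx : x ∈ W) : τ x = (g x).1 := if_pos hx
  have hτW' {x : V} (hx : x ∉ W) : τ x = Quotient.mk p x := if_neg hx
  have hXW : X ⊆ W := subset_saturation q X
  have hτ (x : V) : ∃ h ∈ K₃, h • x ∉ X ∧ τ x = Quotient.mk p (h • x) := by
    by_cases hx : x ∈ W
    · obtain ⟨-, x', hxx', i, hi, hiX, hiτ⟩ := hg2 x hx
      obtain ⟨k, hk, rfl⟩ := hq x x' hxx'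
      obtain ⟨hi1, hi2⟩ := Finset.mem_product.1 hi
      refine ⟨(i.2⁻¹ * i.1) * k, Finset.mem_insert_of_mem
        (Finset.mul_mem_mul (Finset.mul_mem_mul (Finset.inv_mem_inv hi2) hi1) hk), ?_, ?_⟩
      · rwa [mul_smul]
      · rw [hτW hx, ← hiτ, mul_smul (i.2⁻¹ * i.1) k]
    · exact ⟨1, Finset.mem_insert_self _ _, by rw [one_smul]; exact fun h => hx (hXW h),
        by rw [one_smul, hτW' hx]⟩
  have hbound : BoundedBy (K₃⁻¹ * (K * K₃)) (Setoid.ker τ) := by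
    intro x y hxy
    have hxy : τ x = τ y := hxy
    obtain ⟨a, ha, -, hτa⟩ := hτ x
    obtain ⟨b, hb, -, hτb⟩ := hτ y
    obtain ⟨k, hk, hkab⟩ := hp (a • x) (b • y) (Quotient.exact (by rw [← hτa, ← hτb, hxy]))
    refine ⟨b⁻¹ * (k * a), Finset.mul_mem_mul (Finset.inv_mem_inv hb)
      (Finset.mul_mem_mul hk ha), ?_⟩
    rw [mul_smul, mul_smul, ← hkab, inv_smul_smul]
  refine ⟨Setoid.ker τ, hbound, fun x hx => ?_, fun x₀ => ?_⟩
  · by_contra hxq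
    simp only [bdry, Set.mem_ofPred_eq, not_exists, not_and, not_not] at hxq
    obtain ⟨σ, hσ, hne⟩ := hx
    apply hne
    change τ x = τ (σ • x)
    have hq' := hxq σ hσ
    by_cases hxW : x ∈ W
    · have hσW : σ • x ∈ W := (mem_saturation_congr hq').1 hxW
      rw [hτW hxW, hτW hσW, (hg1 x hxW (σ • x) hσW).1 hq']
    · have hσW : σ • x ∉ W := fun h => hxW ((mem_saturation_congr hq').2 h)
      rw [hτW' hxW, hτW' hσW]
      -- Boundary points of `p` belong to `X ⊆ W`, so outside `W` there is no cut by `p`.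
      apply Quotient.sound
      by_contra hnp
      exact hxW (hXW (Or.inl ⟨σ, hσ, hnp⟩))
  · obtain ⟨h, -, hzX, hτz⟩ := hτ x₀
    set z := h • x₀
    set D := cell K p z with hD
    set T := cell (K₃⁻¹ * (K * K₃)) (Setoid.ker τ) x₀ with hT
    have hmemT (y : V) : y ∈ T ↔ τ y = Quotient.mk p z := by
      rw [hT, hbound.mem_cell, ← hτz]
      exact eq_comm
    have hmemD (y : V) : y ∈ D ↔ Quotient.mk p y = Quotient.mk p z := by
      rw [hD, hp.mem_cell]
      exact ⟨fun h => Quotient.sound (p.symm h), fun h => p.symm (Quotient.exact h)⟩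
    have hDW : ((D.filter (· ∈ W)).card : ℝ) ≤ κ * (ε' * D.card) := by
      have h1 : ((D.filter (· ∈ W)).card : ℝ) ≤ κ * bdryCard S K p z := by
        exact_mod_cast hκ q p K ε' hq hp z hzX
      refine h1.trans (mul_le_mul_of_nonneg_left ?_ (Nat.cast_nonneg _))
      by_contra hlt
      exact hzX (Or.inr (not_le.1 hlt))
    -- The absorbed part consists of at most `capacity` classes of `q`, each with at most `M`
    -- points; the `M` in the denominator of the capacity cancels.
    have hTW : ((T.filter (· ∈ W)).card : ℝ) ≤ ε * D.card / 8 := by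
      have h1 : (T.filter (· ∈ W)).card ≤
          L.card * ((T.filter (· ∈ W)).image fun y => (g y).2).card := by
        refine Finset.card_le_mul_card_image _ _ fun j hj => ?_
        obtain ⟨y, hy, rfl⟩ := Finset.mem_image.1 hj
        obtain ⟨hyT, hyW⟩ := Finset.mem_filter.1 hy
        refine (Finset.card_le_card ?_).trans (card_cell_le L q y)
        intro w hw
        obtain ⟨hw, hwy⟩ := Finset.mem_filter.1 hw
        obtain ⟨hwT, hwW⟩ := Finset.mem_filter.1 hw
        rw [hq.mem_cell, hg1 y hyW w hwW]
        have h2 : (g y).1 = (g w).1 := by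
          rw [← hτW hyW, ← hτW hwW, (hmemT y).1 hyT, (hmemT w).1 hwT]
        exact Sigma.ext h2 (heq_of_eq hwy.symm)
      have h2 : ((T.filter (· ∈ W)).image fun y => (g y).2).card ≤
          capacity K p ε M (Quotient.mk p z) := by
        refine (Finset.card_le_card (t := Finset.range _) ?_).trans (Finset.card_range _).le
        intro j hj
        obtain ⟨y, hy, rfl⟩ := Finset.mem_image.1 hj
        obtain ⟨hyT, hyW⟩ := Finset.mem_filter.1 hy
        rw [Finset.mem_range, ← (hmemT y).1 hyT, hτW hyW]
        exact (hg2 y hyW).1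
      have h3 : (capacity K p ε M (Quotient.mk p z) : ℝ) ≤ ε * D.card / (8 * M) := by
        rw [capacity, hp.cell_out]
        exact Nat.floor_le (by positivity)
      have h4 : ((T.filter (· ∈ W)).card : ℝ) ≤
          L.card * capacity K p ε M (Quotient.mk p z) := by
        exact_mod_cast h1.trans (Nat.mul_le_mul_left _ h2)
      calc ((T.filter (· ∈ W)).card : ℝ) ≤ M * (ε * D.card / (8 * M)) :=
            h4.trans (mul_le_mul hLM h3 (Nat.cast_nonneg _) hM.le)
        _ = ε * D.card / 8 := by field_simp
    have hTD : (D.card : ℝ) ≤ T.card + (D.filter (· ∈ W)).card := by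
      have h1 : D ⊆ T ∪ D.filter (· ∈ W) := by
        intro y hy
        by_cases hyW : y ∈ W
        · exact Finset.mem_union_right _ (Finset.mem_filter.2 ⟨hy, hyW⟩)
        · refine Finset.mem_union_left _ ((hmemT y).2 ?_)
          rw [hτW' hyW]
          exact (hmemD y).1 hy
      exact_mod_cast (Finset.card_le_card h1).trans (Finset.card_union_le _ _)
    -- A new boundary point is either absorbed or has a neighbour among the points that `D` shares
    -- with `W`.
    have hbd : (bdryCard S (K₃⁻¹ * (K * K₃)) (Setoid.ker τ) x₀ : ℝ) ≤
        (T.filter (· ∈ W)).card + S.card * (D.filter (· ∈ W)).card := by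
      have h1 : T.filter (· ∈ bdry S (Setoid.ker τ)) ⊆ T.filter (· ∈ W) ∪
          S.biUnion fun σ => (D.filter (· ∈ W)).image (σ⁻¹ • ·) := by
        intro y hy
        obtain ⟨hyT, σ, hσ, hne⟩ := Finset.mem_filter.1 hy
        by_cases hyW : y ∈ W
        · exact Finset.mem_union_left _ (Finset.mem_filter.2 ⟨hyT, hyW⟩)
        · have hτy := (hmemT y).1 hyT
          have hpσ : p y (σ • y) := by
            by_contra hnp
            exact hyW (hXW (Or.inl ⟨σ, hσ, hnp⟩))
          have hyz : Quotient.mk p (σ • y) = Quotient.mk p z := by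
            rw [← hτy, hτW' hyW]
            exact (Quotient.sound hpσ).symm
          refine Finset.mem_union_right _ (Finset.mem_biUnion.2 ⟨σ, hσ, Finset.mem_image.2
            ⟨σ • y, Finset.mem_filter.2 ⟨(hmemD _).2 hyz, ?_⟩, inv_smul_smul σ y⟩⟩)
          by_contra hσW
          apply hne
          change τ y = τ (σ • y)
          rw [hτy, hτW' hσW, hyz]
      have h2 := (Finset.card_le_card h1).trans ((Finset.card_union_le _ _).trans
        (Nat.add_le_add_left (Finset.card_biUnion_le_card_mul _ _ _
          fun σ _ => Finset.card_image_le) _))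
      rw [bdryCard]
      exact_mod_cast h2
    have hDpos : (0 : ℝ) < D.card := by
      exact_mod_cast Finset.card_pos.2 ⟨z, hp.self_mem_cell z⟩
    have hS : S.card * ((D.filter (· ∈ W)).card : ℝ) ≤ ε / 8 * D.card := by
      calc S.card * ((D.filter (· ∈ W)).card : ℝ) ≤ S.card * (κ * (ε' * D.card)) :=
            mul_le_mul_of_nonneg_left hDW (Nat.cast_nonneg _)
        _ = S.card * (κ * ε') * D.card := by ring
        _ ≤ ε / 8 * D.card := mul_le_mul_of_nonneg_right hκ2 hDpos.le
    have hhalf : (D.card : ℝ) / 2 ≤ T.card := by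
      have : κ * (ε' * D.card) ≤ 1 / 2 * D.card := by
        rw [← mul_assoc]
        exact mul_le_mul_of_nonneg_right hκ1 hDpos.le
      linarith
    -- The two parts of the boundary have at most `ε * D.card / 8` points each, together less than
    -- `ε * D.card / 2 ≤ ε * T.card`.
    have hfin := mul_le_mul_of_nonneg_left hhalf hε.le
    have hpos := mul_pos hε hDpos
    linarith

/-- A transitive action of an amenable group has a random tiling by Følner sets, uniformly
distributed on finitely many tilings, such that each point is unlikely to be on the boundary. -/
theorem exists_folner_partition_family (V : Type*) [MulAction Γ V] [MulAction.IsPretransitive Γ V]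
    (h : IsAmenableGroup Γ) {S : Finset Γ} (hsymm : ∀ σ ∈ S, σ⁻¹ ∈ S)
    (hgen : Subgroup.closure (S : Set Γ) = ⊤) {ε : ℝ} (hε : 0 < ε) :
    ∃ (ι : Type) (_ : Fintype ι) (_ : Nonempty ι) (t : ι → Setoid V) (K : Finset Γ),
      (∀ i, BoundedBy K (t i)) ∧
      (∀ i x, (bdryCard S K (t i) x : ℝ) < ε * (cell K (t i) x).card) ∧
      ∀ x, (Nat.card {i // x ∈ bdry S (t i)} : ℝ) ≤ ε / 2 * Fintype.card ι := by
  classical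
  -- A finite `V` is a single tile without boundary. For infinite `V`, transitivity forces every
  -- finite class to have a boundary point, as the lower bound on capacities requires.
  rcases finite_or_infinite V with hV | hV
  · have := Fintype.ofFinite V
    choose γ hγ using fun w : V × V => MulAction.exists_smul_eq Γ w.1 w.2
    have hb : BoundedBy (Finset.univ.image γ) (⊤ : Setoid V) := fun x y _ =>
      ⟨γ (x, y), Finset.mem_image_of_mem _ (Finset.mem_univ _), (hγ (x, y)).symm⟩
    have hbd : bdry S (⊤ : Setoid V) = ∅ :=
      Set.eq_empty_of_forall_notMem fun x ⟨σ, _, h⟩ => h trivial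
    refine ⟨Unit, inferInstance, inferInstance, fun _ => ⊤, Finset.univ.image γ,
      fun _ => hb, fun _ x => ?_, fun x => ?_⟩
    · have hpos : 0 < (cell (Finset.univ.image γ) (⊤ : Setoid V) x).card :=
        Finset.card_pos.2 ⟨x, hb.self_mem_cell x⟩
      simp only [bdryCard, hbd, Set.mem_empty_iff_false, Finset.filter_false, Finset.card_empty,
        Nat.cast_zero]
      positivity
    · simp only [hbd, Set.mem_empty_iff_false, Nat.card_of_isEmpty, Nat.cast_zero]
      positivity
  · obtain ⟨ι, _, _, q, L, hL, hq⟩ := exists_partition_family V h S (half_pos hε)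
    obtain ⟨κ, hκ⟩ := exists_card_filter_saturation_le hsymm hgen V L
    set M : ℝ := L.card + 1 with hM
    have hMpos : 0 < M := by positivity
    have hM1 : 1 ≤ M := by simp [hM]
    -- Capping at 1 keeps `η` below `1 / 2`, so that `16 * M * η = ε₁ / 2 ≤ ε₁ * (1 - η)`.
    set ε₁ : ℝ := min ε 1 with hε₁
    have hε₁pos : 0 < ε₁ := lt_min hε one_pos
    have hε₁le : ε₁ ≤ 1 := min_le_right _ _
    set ε' : ℝ := ε₁ / (8 * M * (κ + 1) * (S.card + 1)) with hε'
    have hε'pos : 0 < ε' := by positivity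
    have hε'eq : 8 * M * (κ + 1) * (S.card + 1) * ε' = ε₁ := by
      rw [hε']
      field_simp
    have hκ0 : (0 : ℝ) ≤ κ := Nat.cast_nonneg _
    have hS0 : (0 : ℝ) ≤ S.card := Nat.cast_nonneg _
    have hε'le {a : ℝ} (ha : a ≤ M * (κ + 1) * (S.card + 1)) : 8 * (a * ε') ≤ ε₁ := by
      rw [← hε'eq]
      nlinarith [mul_le_mul_of_nonneg_right ha hε'pos.le]
    have hMκ : M * κ ≤ M * (κ + 1) := by nlinarith
    have e1 : (κ : ℝ) ≤ M * (κ + 1) := by nlinarith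
    have e2 : 0 ≤ M * (κ + 1) * S.card := by positivity
    have e3 : S.card * (κ : ℝ) ≤ S.card * (M * (κ + 1)) := mul_le_mul_of_nonneg_left e1 hS0
    set η : ℝ := ε₁ / (32 * M) with hη
    have hηpos : 0 < η := by positivity
    have hηeq : 32 * M * η = ε₁ := by
      rw [hη]
      field_simp
    have hη2 : η ≤ 1 / 2 := by nlinarith
    obtain ⟨p, K, E, hp, hE, hX⟩ := exists_sparse_excSet V h hsymm hgen hε'pos hηpos
    have hbig (x : V) : 1 ≤ bdryCard S K p x := by
      obtain ⟨y, hy⟩ := Infinite.exists_notMem_finset (cell K p x)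
      obtain ⟨k, hk⟩ := MulAction.exists_smul_eq Γ x y
      obtain ⟨K', hK'⟩ := exists_exit hsymm hgen V {k}
      obtain ⟨k', -, h1, σ, hσ, h2⟩ := hK' {y | p x y} x (p.refl x) k (Finset.mem_singleton_self k)
        (by rw [hk]; exact fun h => hy (hp.mem_cell.2 h))
      refine Finset.card_pos.2 ⟨k' • x, Finset.mem_filter.2 ⟨hp.mem_cell.2 h1, σ, hσ, ?_⟩⟩
      exact fun h3 => h2 (p.trans h1 h3)
    obtain ⟨K', hK'⟩ := exists_folner_partition (L := L) (κ := κ) (ε := ε₁) (M := M)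
      hp hE hbig hX hMpos hηpos hε₁pos
      (by have := hε'le (a := M) (by nlinarith); linarith)
      (by nlinarith) (by simp [hM]) hκ
      (by have := hε'le (a := κ) (by nlinarith); linarith)
      (by have := hε'le (a := S.card * κ) (by nlinarith); linarith)
    choose t ht htb htF using fun i => hK' (q i) (hL i)
    refine ⟨ι, inferInstance, inferInstance, t, K', ht, fun i x => ?_, fun x => ?_⟩
    · exact (htF i x).trans_le (mul_le_mul_of_nonneg_right (min_le_left _ _) (Nat.cast_nonneg _))
    · refine le_trans ?_ (hq x)
      rw [Nat.card_eq_fintype_card, Fintype.card_subtype]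
      exact_mod_cast Finset.card_le_card fun i hi =>
        Finset.mem_filter.2 ⟨Finset.mem_univ _, htb i (Finset.mem_filter.1 hi).2⟩

end Tiling

/-! ### From finite families of partitions to measures on packings -/

section Conversion

theorem countable_of_closure_eq_top {Γ : Type*} [Group Γ] {S : Finset Γ}
    (hsymm : ∀ σ ∈ S, σ⁻¹ ∈ S) (hgen : Subgroup.closure (S : Set Γ) = ⊤) : Countable Γ := by
  refine Function.Surjective.countable (f := fun l : List S => (l.map Subtype.val).prod) fun g => ?_
  have hg : g ∈ (Subgroup.closure (S : Set Γ)).toSubmonoid := by simp [hgen]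
  rw [Subgroup.closure_toSubmonoid] at hg
  obtain ⟨l, hl, rfl⟩ := Submonoid.exists_list_of_mem_closure hg
  have hl' : ∀ x ∈ l, x ∈ S := fun x hx =>
    (hl x hx).elim id fun h => inv_inv x ▸ hsymm x⁻¹ h
  lift l to List S using hl'
  exact ⟨l, rfl⟩

namespace FolnerPacking

variable {V : Type*} {G : SimpleGraph V} {ε : ℝ} {r : ℕ}

theorem measurableSet_sameTile (x y : V) :
    MeasurableSet {P : FolnerPacking G ε r | P.SameTile x y} := by
  classical
  apply IsOpen.measurableSet
  refine isOpen_induced_iff.2 ⟨(fun f : V × V → Bool => f (x, y)) ⁻¹' {true},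
    (isOpen_discrete _).preimage (continuous_apply _), ?_⟩
  ext P
  simp

theorem measurableSet_isTiling [Countable V] :
    MeasurableSet {P : FolnerPacking G ε r | P.IsTiling} := by
  have h : {P : FolnerPacking G ε r | P.IsTiling} = ⋂ x, {P | P.SameTile x x} := by
    ext P
    simp [IsTiling, SameTile]
  rw [h]
  exact MeasurableSet.iInter fun x => measurableSet_sameTile x x

-- Disjointness makes the tile of `x` unique, so the boundary event depends only on the relation
-- `SameTile`. This makes it measurable.
open Classical in
theorem exists_mem_innerBoundary_iff (P : FolnerPacking G ε r) (x : V) :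
    (∃ T ∈ P.tiles, x ∈ innerBoundary G T) ↔
      P.SameTile x x ∧ ∃ y, G.Adj x y ∧ ¬ P.SameTile x y := by
  constructor
  · rintro ⟨T, hT, hx⟩
    obtain ⟨hxT, y, hxy, hyT⟩ := Finset.mem_filter.1 hx
    refine ⟨⟨T, hT, hxT, hxT⟩, y, hxy, ?_⟩
    rintro ⟨T', hT', hxT', hyT'⟩
    have hne : T ≠ T' := fun h => hyT (h ▸ hyT')
    exact Finset.disjoint_left.1 (P.pairwiseDisjoint T hT T' hT' hne) hxT hxT'
  · rintro ⟨⟨T, hT, hxT, -⟩, y, hxy, hne⟩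
    exact ⟨T, hT, Finset.mem_filter.2 ⟨hxT, y, hxy, fun hyT => hne ⟨T, hT, hxT, hyT⟩⟩⟩

theorem measurableSet_mem_innerBoundary [Countable V] (x : V) :
    MeasurableSet {P : FolnerPacking G ε r | ∃ T ∈ P.tiles, x ∈ innerBoundary G T} := by
  have h : {P : FolnerPacking G ε r | ∃ T ∈ P.tiles, x ∈ innerBoundary G T} =
      {P | P.SameTile x x} ∩ ⋃ y, ⋃ _ : G.Adj x y, {P | P.SameTile x y}ᶜ := by
    ext P
    simp [exists_mem_innerBoundary_iff]
  rw [h]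
  exact (measurableSet_sameTile x x).inter (MeasurableSet.iUnion fun y =>
    MeasurableSet.iUnion fun _ => (measurableSet_sameTile x y).compl)

end FolnerPacking

variable {Γ V : Type*} [Group Γ] [MulAction Γ V]

/-- The word length of `k` bounds its displacement at every point simultaneously, which turns
`K`-boundedness into a uniform bound on diameters. -/
theorem exists_edist_smul_le {S : Finset Γ} (hgen : Subgroup.closure (S : Set Γ) = ⊤)
    {G : SimpleGraph V} (hG : ∀ x y, G.Adj x y ↔ x ≠ y ∧ ∃ σ ∈ S, y = σ • x) (k : Γ) :
    ∃ n : ℕ, ∀ x : V, G.edist x (k • x) ≤ n := by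
  have hk : k ∈ Subgroup.closure (S : Set Γ) := hgen ▸ Subgroup.mem_top k
  induction hk using Subgroup.closure_induction with
  | mem k hk =>
    refine ⟨1, fun x => ?_⟩
    by_cases h : x = k • x
    · rw [← h]
      simp
    · exact (SimpleGraph.edist_eq_one_iff_adj.2 ((hG _ _).2 ⟨h, k, hk, rfl⟩)).le
  | one => exact ⟨0, fun x => by simp⟩
  | mul k l _ _ ihk ihl =>
    obtain ⟨m, hm⟩ := ihk
    obtain ⟨n, hn⟩ := ihl
    refine ⟨n + m, fun x => (SimpleGraph.edist_triangle (v := l • x)).trans ?_⟩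
    rw [mul_smul]
    push_cast
    exact add_le_add (hn x) (hm _)
  | inv k _ ih =>
    obtain ⟨n, hn⟩ := ih
    refine ⟨n, fun x => ?_⟩
    rw [SimpleGraph.edist_comm]
    simpa using hn (k⁻¹ • x)

open Classical in
theorem BoundedBy.mem_innerBoundary_cell {S K : Finset Γ} {G : SimpleGraph V} {t : Setoid V}
    (hG : ∀ x y, G.Adj x y ↔ x ≠ y ∧ ∃ σ ∈ S, y = σ • x) (ht : BoundedBy K t) (x y : V) :
    y ∈ innerBoundary G (cell K t x) ↔ y ∈ cell K t x ∧ y ∈ bdry S t := by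
  rw [innerBoundary, Finset.mem_filter]
  refine and_congr_right fun hy => ?_
  have hxy := ht.mem_cell.1 hy
  constructor
  · rintro ⟨w, hw, hne⟩
    obtain ⟨-, σ, hσ, rfl⟩ := (hG _ _).1 hw
    exact ⟨σ, hσ, fun h => hne (ht.mem_cell.2 (t.trans hxy h))⟩
  · rintro ⟨σ, hσ, hne⟩
    refine ⟨σ • y, (hG _ _).2 ⟨fun h => hne (h ▸ t.refl y), σ, hσ, rfl⟩, fun h => hne ?_⟩
    exact t.trans (t.symm hxy) (ht.mem_cell.1 h)

open Classical in
/-- The classes of a partition into Følner sets as a packing. -/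
noncomputable def FolnerPacking.ofSetoid {S K : Finset Γ} {G : SimpleGraph V} {t : Setoid V}
    {ε : ℝ} {r : ℕ} (hG : ∀ x y, G.Adj x y ↔ x ≠ y ∧ ∃ σ ∈ S, y = σ • x) (ht : BoundedBy K t)
    (hF : ∀ x, (bdryCard S K t x : ℝ) < ε * (cell K t x).card)
    (hr : ∀ k ∈ K, ∀ x : V, G.edist x (k • x) ≤ r) : FolnerPacking G ε r where
  tiles := Set.range (cell K t)
  pairwiseDisjoint := by
    rintro _ ⟨x, rfl⟩ _ ⟨y, rfl⟩ hne
    refine Finset.disjoint_left.2 fun z hx hy => hne (ht.cell_eq ?_)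
    exact t.trans (ht.mem_cell.1 hx) (t.symm (ht.mem_cell.1 hy))
  isFolnerSet := by
    rintro _ ⟨x, rfl⟩
    have hne : (cell K t x).Nonempty := ⟨x, ht.self_mem_cell x⟩
    refine ⟨hne, ?_⟩
    rw [div_lt_iff₀ (by exact_mod_cast hne.card_pos)]
    have hcard : (innerBoundary G (cell K t x)).card = bdryCard S K t x := by
      rw [bdryCard]
      congr 1
      ext y
      rw [ht.mem_innerBoundary_cell hG, Finset.mem_filter]
    rw [hcard]
    exact hF x
  diam_le := by
    rintro _ ⟨z, rfl⟩ x hx y hy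
    obtain ⟨k, hk, rfl⟩ := ht x y (t.trans (t.symm (ht.mem_cell.1 hx)) (ht.mem_cell.1 hy))
    exact hr k hk x

open MeasureTheory ENNReal in
/-- The graph of a transitive action of an amenable group is strongly almost finite. -/
theorem isStronglyAlmostFinite_of_isPretransitive [MulAction.IsPretransitive Γ V]
    (hΓ : IsAmenableGroup Γ) {S : Finset Γ} (hsymm : ∀ σ ∈ S, σ⁻¹ ∈ S)
    (hgen : Subgroup.closure (S : Set Γ) = ⊤) {G : SimpleGraph V}
    (hG : ∀ x y, G.Adj x y ↔ x ≠ y ∧ ∃ σ ∈ S, y = σ • x) : IsStronglyAlmostFinite G := by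
  classical
  have hcΓ : Countable Γ := countable_of_closure_eq_top hsymm hgen
  have hcV : Countable V := by
    rcases isEmpty_or_nonempty V with hV | ⟨⟨x⟩⟩
    · infer_instance
    · exact (MulAction.surjective_smul Γ x).countable
  refine ⟨⟨S.card, hcV, fun x => ?_⟩, fun ε hε => ?_⟩
  · have hsub : G.neighborSet x ⊆ (S.image (· • x) : Finset V) := by
      intro y hy
      obtain ⟨-, σ, hσ, rfl⟩ := (hG x y).1 hy
      exact Finset.mem_coe.2 (Finset.mem_image_of_mem _ hσ)
    refine (Set.encard_le_encard hsub).trans ?_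
    rw [Set.encard_coe_eq_coe_finsetCard]
    exact_mod_cast Finset.card_image_le
  · obtain ⟨ι, _, _, t, K, htK, htF, htb⟩ := exists_folner_partition_family V hΓ hsymm hgen hε
    choose n hn using exists_edist_smul_le (V := V) hgen hG
    -- The summand 1 only ensures that the diameter bound is at least 1.
    have hr (k : Γ) (hk : k ∈ K) (x : V) : G.edist x (k • x) ≤ (K.sup n + 1 : ℕ) :=
      (hn k x).trans (by exact_mod_cast (Finset.le_sup (f := n) hk).trans (Nat.le_succ _))
    let P : ι → FolnerPacking G ε (K.sup n + 1) := fun i =>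
      FolnerPacking.ofSetoid hG (htK i) (htF i) hr
    -- The uniform distribution on the family. Boundary probabilities are at most `ε / 2`, which
    -- leaves room for the strict inequality.
    let ν : Measure (FolnerPacking G ε (K.sup n + 1)) :=
      (Fintype.card ι : ℝ≥0∞)⁻¹ • ∑ i, Measure.dirac (P i)
    have hν (s : Set (FolnerPacking G ε (K.sup n + 1))) (hs : MeasurableSet s) :
        ν s = (Fintype.card ι : ℝ≥0∞)⁻¹ * Nat.card {i // P i ∈ s} := by
      simp only [ν, Measure.smul_apply, Measure.finsetSum_apply, Measure.dirac_apply' _ hs,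
        smul_eq_mul, Set.indicator_apply, Pi.one_apply]
      rw [Finset.sum_boole, Nat.card_eq_fintype_card, Fintype.card_subtype]
    have hι0 : (Fintype.card ι : ℝ≥0∞) ≠ 0 := by simp
    have hιtop : (Fintype.card ι : ℝ≥0∞) ≠ ∞ := ENNReal.natCast_ne_top _
    refine ⟨K.sup n + 1, Nat.le_add_left _ _, ν, ⟨?_⟩, ?_, fun x => ?_⟩
    · rw [hν _ MeasurableSet.univ]
      simpa using ENNReal.inv_mul_cancel hι0 hιtop
    · have htil (i : ι) : (P i).IsTiling := fun x => ⟨_, ⟨x, rfl⟩, (htK i).self_mem_cell x⟩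
      change ν {P | P.IsTiling}ᶜ = 0
      have := hν _ (FolnerPacking.measurableSet_isTiling (G := G) (ε := ε)
        (r := K.sup n + 1)).compl
      simpa [htil] using this
    · rw [hν _ (FolnerPacking.measurableSet_mem_innerBoundary x)]
      have hiff (i : ι) : P i ∈ {Q : FolnerPacking G ε (K.sup n + 1) |
          ∃ T ∈ Q.tiles, x ∈ innerBoundary G T} → x ∈ bdry S (t i) := by
        rintro ⟨_, ⟨z, rfl⟩, hx⟩
        exact (((htK i).mem_innerBoundary_cell hG z x).1 hx).2
      have hle : Nat.card {i // P i ∈ {Q : FolnerPacking G ε (K.sup n + 1) |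
          ∃ T ∈ Q.tiles, x ∈ innerBoundary G T}} ≤ Nat.card {i // x ∈ bdry S (t i)} :=
        Nat.card_le_card_of_injective (fun i => ⟨i.1, hiff i.1 i.2⟩) fun i j h =>
          Subtype.ext (congrArg (fun w => w.1) h)
      have hle' : (Nat.card {i // P i ∈ {Q : FolnerPacking G ε (K.sup n + 1) |
          ∃ T ∈ Q.tiles, x ∈ innerBoundary G T}} : ℝ) ≤ ε / 2 * Fintype.card ι :=
        (by exact_mod_cast hle : (_ : ℝ) ≤ _).trans (htb x)
      have hlt : ENNReal.ofReal (ε / 2) < ENNReal.ofReal ε :=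
        (ENNReal.ofReal_lt_ofReal_iff hε).2 (half_lt_self hε)
      refine lt_of_le_of_lt ?_ hlt
      rw [mul_comm, ← div_eq_mul_inv, ENNReal.div_le_iff hι0 hιtop,
        ← ENNReal.ofReal_natCast, ← ENNReal.ofReal_natCast,
        ← ENNReal.ofReal_mul (by positivity)]
      exact ENNReal.ofReal_le_ofReal hle'

end Conversion

/-! ### Schreier graphs as graphs of transitive actions -/

section Schreier

variable {Γ : Type*} [Group Γ]

/-- The action of `Γ` on the right cosets of `H` by `g • H a = H a g⁻¹`. -/
@[reducible]
def rightCosetMulAction (H : Subgroup Γ) : MulAction Γ (RightCoset H) where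
  smul g := Quotient.map (· * g⁻¹) fun a b hab => by
    have hab : QuotientGroup.rightRel H a b := hab
    rw [QuotientGroup.rightRel_apply] at hab
    change QuotientGroup.rightRel H _ _
    rw [QuotientGroup.rightRel_apply]
    simpa [mul_assoc] using hab
  one_smul x := by
    induction x using Quotient.inductionOn with
    | h a => exact congrArg (rightCoset H) (by simp)
  mul_smul g h x := by
    induction x using Quotient.inductionOn with
    | h a => exact congrArg (rightCoset H) (by simp [mul_assoc])

end Schreier

theorem mainTheorem8 {Γ : Type*} [Group Γ] (hΓ : IsAmenableGroup Γ)
    (S : Finset Γ) (hsymm : ∀ σ ∈ S, σ⁻¹ ∈ S) (hgen : Subgroup.closure (S : Set Γ) = ⊤)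
    (H : Subgroup Γ) :
    IsStronglyAlmostFinite (schreierGraph H S hsymm) := by
  let _ := rightCosetMulAction H
  have hsmul (g a : Γ) : g • rightCoset H a = rightCoset H (a * g⁻¹) := rfl
  have : MulAction.IsPretransitive Γ (RightCoset H) := ⟨fun x y => by
    induction x using Quotient.inductionOn with
    | h a =>
      induction y using Quotient.inductionOn with
      | h b => exact ⟨b⁻¹ * a, (hsmul _ a).trans (congrArg (rightCoset H) (by simp))⟩⟩
  refine isStronglyAlmostFinite_of_isPretransitive hΓ hsymm hgen fun x y => ?_
  refine and_congr_right fun _ => ⟨?_, ?_⟩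
  -- A left action on right cosets has to multiply by inverses, so `σ` acts as the edge labelled
  -- `σ⁻¹`; symmetry of `S` absorbs this.
  · rintro ⟨a, σ, hσ, rfl, rfl⟩
    exact ⟨σ⁻¹, hsymm σ hσ, by rw [hsmul, inv_inv]⟩
  · rintro ⟨σ, hσ, rfl⟩
    induction x using Quotient.inductionOn with
    | h a => exact ⟨a, σ⁻¹, hsymm σ hσ, rfl, hsmul σ a⟩
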